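/- Let $M$ be a smooth oriented Riemannian manifold (without boundary) of dimension $3$, with Levi-Civita connection $\nabla$, Hodge star $*$ (determined by $\beta\wedge *\gamma=\langle\beta,\gamma\rangle\,\mathrm{vol}$), codifferential $d^{*}=(-1)^{3(r+1)+1}*d*$ on $r$-forms (the formal $L^2$-adjoint of the exterior derivative $d$), and De Rham–Hodge Laplacian $\square=dd^{*}+d^{*}d$. For a vector field $A$, let $\tilde A=\langle A,\cdot\rangle$ be the dual $1$-form, let $\square A$ be the vector field dual to $\square\tilde A$, let $\operatorname{div}A=\operatorname{Trace}(\nabla A)$, and let $\nabla^{s}A$ be the symmetric part of $\nabla A$, i.e. the $(1,1)$-tensor with $$\langle \nabla^{s}_XA,Y\rangle=\tfrac12\bigl(\langle\nabla_XA,Y\rangle+\langle\nabla_YA,X\rangle\bigr).$$ For a $p$-form $\beta$ and a $(1,1)$-tensor $T$ put $(\beta\odot T)(X_1,\dots,X_p)=\sum_{i=1}^{p}\beta(X_1,\dots,T(X_i),\dots,X_p)$. Let $\nu\in\mathbb R$, let $J\subset\mathbb R$ be an interval with more than one point (for instance $[0,T]$ or $[0,\infty)$), and let $(u_t,p_t)_{t\in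 J}$ be a smooth solution on $M$ of the Navier–Stokes equation $$\partial_tu_t+\nabla_{u_t}u_t+\nu\,\square u_t=-\nabla p_t,\qquad \operatorname{div}(u_t)=0,$$ that is, $u$ is smooth jointly in $(t,x)\in J\times M$ and each $p_t$ is a smooth function on $M$. Then the vorticity $\omega_t=*\,d\tilde u_t$, a $1$-form on $M$, is differentiable in $t$ at each point of $M$ and satisfies, for all $t\in J$ and at every point of $M$, $$\partial_t\omega_t+\nabla_{u_t}\omega_t+\nu\,\square\omega_t=\omega_t\odot\nabla^{s}u_t .$$ (At end points of $J$, $\partial_t$ is the one-sided derivative.) -/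

import Mathlib

open Bundle Module
open scoped Manifold ContDiff Topology

namespace NSVorticity

noncomputable section

/-! ### Exterior algebra of a single (tangent) space -/

section LinearAlgebra

/-- The operation `β ⊙ T` of an endomorphism `T` on a `p`-form `β`:
`(β ⊙ T)(X₁, …, X_p) = ∑ᵢ β(X₁, …, T Xᵢ, …, X_p)`. -/
def insertEndo {V : Type*} [AddCommGroup V] [Module ℝ V] [TopologicalSpace V] {p : ℕ}
    (β : V [⋀^Fin p]→L[ℝ] ℝ) (T : V →L[ℝ] V) : V [⋀^Fin p]→L[ℝ] ℝ where
  toFun X := ∑ i, β (Function.update X i (T (X i)))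
  map_update_add' := by
    intro inst X j a b
    rw [← Finset.sum_add_distrib]
    refine Finset.sum_congr rfl fun i _ => ?_
    have hinst : inst = instDecidableEqFin p := Subsingleton.elim _ _
    subst hinst
    by_cases h : i = j
    · subst h; simp
    · have h' : j ≠ i := fun e => h e.symm
      simp [Function.update_of_ne h, Function.update_comm h']
  map_update_smul' := by
    intro inst X j c a
    rw [Finset.smul_sum]
    refine Finset.sum_congr rfl fun i _ => ?_
    have hinst : inst = instDecidableEqFin p := Subsingleton.elim _ _
    subst hinst
    by_cases h : i = j
    · subst h; simp
    · have h' : j ≠ i := fun e => h e.symm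
      simp [Function.update_of_ne h, Function.update_comm h']
  map_eq_zero_of_eq' := by
    intro X j k hX hjk
    have hz : ∀ i, i ≠ j → i ≠ k → β (Function.update X i (T (X i))) = 0 := by
      intro i hij hik
      refine β.map_eq_zero_of_eq _ (i := j) (j := k) ?_ hjk
      simp [Function.update_of_ne (Ne.symm hij), Function.update_of_ne (Ne.symm hik), hX]
    have hsum : ∑ i, β (Function.update X i (T (X i)))
        = β (Function.update X j (T (X j))) + β (Function.update X k (T (X k))) :=
      Fintype.sum_eq_add j k hjk fun i hi => hz i hi.1 hi.2
    have hsw : Function.update X k (T (X k))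
        = Function.update X j (T (X j)) ∘ Equiv.swap j k := by
      funext i
      by_cases h1 : i = j
      · subst h1
        simp [Function.update_of_ne hjk, Function.update_of_ne hjk.symm, hX]
      · by_cases h2 : i = k
        · subst h2; simp [hX]
        · simp [Equiv.swap_apply_of_ne_of_ne h1 h2, Function.update_of_ne h1,
            Function.update_of_ne h2]
    change ∑ i, β (Function.update X i (T (X i))) = 0
    rw [hsum, hsw]
    have := β.toAlternatingMap.map_swap (Function.update X j (T (X j))) hjk
    have h3 : β (Function.update X j (T (X j)) ∘ Equiv.swap j k)
        = - β (Function.update X j (T (X j))) := this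
    rw [h3]; ring
  cont := by
    change Continuous fun X : Fin p → V => ∑ i, β (Function.update X i (T (X i)))
    refine continuous_finsetSum _ fun i _ => ?_
    exact β.cont.comp (continuous_id.update i (T.continuous.comp (continuous_apply i)))

variable {V : Type*} [NormedAddCommGroup V] [InnerProductSpace ℝ V]

/-- The interior product of the volume form with the vectors `a₁, …, a_p`:
`(v₁, …, v_q) ↦ vol(a₁, …, a_p, v₁, …, v_q)`. -/
def contractVol {n p q : ℕ} [Fact (finrank ℝ V = n)] (o : Orientation ℝ V (Fin n))
    (h : p + q = n) (a : Fin p → V) : V [⋀^Fin q]→L[ℝ] ℝ :=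
  AlternatingMap.mkContinuous
    { toFun := fun v => o.volumeForm (Fin.append a v ∘ Fin.cast h.symm)
      map_update_add' := by
        intro inst v j x y
        subst h
        have hinst : inst = instDecidableEqFin q := Subsingleton.elim _ _
        subst hinst
        have key : ∀ z, Fin.append a (Function.update v j z) ∘ Fin.cast rfl
            = Function.update (Fin.append a v) (Fin.natAdd p j) z := by
          intro z; funext i
          refine Fin.addCases (fun k => ?_) (fun k => ?_) i
          · have : Fin.castAdd q k ≠ Fin.natAdd p j := by
              intro e; have := congrArg Fin.val e; simp at this; omega
            simp [Function.update_of_ne this]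
          · by_cases hk : k = j
            · subst hk; simp
            · have : Fin.natAdd p k ≠ Fin.natAdd p j := by
                intro e; exact hk (by simpa using e)
              simp [Function.update_of_ne this, Function.update_of_ne hk]
        rw [key, key, key]; exact AlternatingMap.map_update_add _ _ _ _ _
      map_update_smul' := by
        intro inst v j c x
        subst h
        have hinst : inst = instDecidableEqFin q := Subsingleton.elim _ _
        subst hinst
        have key : ∀ z, Fin.append a (Function.update v j z) ∘ Fin.cast rfl
            = Function.update (Fin.append a v) (Fin.natAdd p j) z := by
          intro z; funext i
          refine Fin.addCases (fun k => ?_) (fun k => ?_) i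
          · have : Fin.castAdd q k ≠ Fin.natAdd p j := by
              intro e; have := congrArg Fin.val e; simp at this; omega
            simp [Function.update_of_ne this]
          · by_cases hk : k = j
            · subst hk; simp
            · have : Fin.natAdd p k ≠ Fin.natAdd p j := by
                intro e; exact hk (by simpa using e)
              simp [Function.update_of_ne this, Function.update_of_ne hk]
        rw [key, key]; exact AlternatingMap.map_update_smul _ _ _ _ _
      map_eq_zero_of_eq' := by
        intro v i j hv hij
        subst h
        refine AlternatingMap.map_eq_zero_of_eq _ _ (i := Fin.natAdd p i) (j := Fin.natAdd p j)
          ?_ ?_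
        · simpa using hv
        · intro e; exact hij (by simpa using e) }
    (∏ i, ‖a i‖) (by
      intro v
      subst h
      have := o.abs_volumeForm_apply_le (Fin.append a v ∘ Fin.cast rfl)
      simpa [Fin.prod_univ_add] using this)

/-- The Hodge star `∗ : Λᵖ → Λ^q`, `p + q = n`, of an oriented Euclidean space of dimension `n`:
with respect to an orthonormal basis `e₁, …, e_n`,
`∗β = ∑_{i₁ < ⋯ < i_p} β(e_{i₁}, …, e_{i_p}) vol(e_{i₁}, …, e_{i_p}, ⬝)`. The sum below runs over all
`p`-tuples of indices and is divided by `p!` accordingly. It does not depend on the orthonormal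
basis, and it is the map determined by `β ∧ ∗γ = ⟨β, γ⟩ vol`. -/
def hodgeStar {n p q : ℕ} [Fact (finrank ℝ V = n)] [FiniteDimensional ℝ V]
    (o : Orientation ℝ V (Fin n)) (h : p + q = n)
    (β : V [⋀^Fin p]→L[ℝ] ℝ) : V [⋀^Fin q]→L[ℝ] ℝ :=
  ((p.factorial : ℝ)⁻¹) • ∑ f : Fin p → Fin (finrank ℝ V),
    β (fun i => stdOrthonormalBasis ℝ V (f i)) •
      contractVol o h (fun i => stdOrthonormalBasis ℝ V (f i))

/-- The vector `α^♯` dual to a covector `α`: `⟨α^♯, v⟩ = α v`. -/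
def sharp [FiniteDimensional ℝ V] (α : V →L[ℝ] ℝ) : V :=
  haveI : CompleteSpace V := FiniteDimensional.complete ℝ V
  (InnerProductSpace.toDual ℝ V).symm α

/-- `sharp` as a continuous linear map. -/
def sharpL [FiniteDimensional ℝ V] : (V →L[ℝ] ℝ) →L[ℝ] V :=
  LinearMap.toContinuousLinearMap
    { toFun := sharp
      map_add' := fun α β => by simp [sharp]
      map_smul' := fun c α => by simp [sharp] }

/-- The symmetric part of an endomorphism:
`⟨T^s X, Y⟩ = (⟨T X, Y⟩ + ⟨T Y, X⟩) / 2`. -/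
def symPart [FiniteDimensional ℝ V] (T : V →L[ℝ] V) : V →L[ℝ] V :=
  haveI : CompleteSpace V := FiniteDimensional.complete ℝ V
  (2⁻¹ : ℝ) • (T + ContinuousLinearMap.adjoint T)

/-- The Christoffel symbols of the first kind at `z` of a metric `g` on a vector space, with the
argument `b` fixed: `(a, c) ↦ (D_a g(b, c) + D_b g(a, c) - D_c g(b, a)) / 2`. -/
def christoffelForm {F : Type*} [NormedAddCommGroup F] [NormedSpace ℝ F]
    (g : F → F →L[ℝ] F →L[ℝ] ℝ) (z b : F) : F →L[ℝ] F →L[ℝ] ℝ :=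
  (2⁻¹ : ℝ) • ((fderiv ℝ g z).flip b + fderiv ℝ g z b - ((fderiv ℝ g z).flip b).flip)

end LinearAlgebra

/-! ### Calculus on a Riemannian manifold, through charts

`M` is a manifold modelled on `ℝⁿ`. At each point `x` all objects are computed in the preferred
chart `φ = extChartAt (𝓡 n) x` around `x`. -/

section Manifold

variable {n : ℕ} {M : Type*} [TopologicalSpace M] [ChartedSpace (EuclideanSpace ℝ (Fin n)) M]

/-- The model space `ℝⁿ`. -/
abbrev Model (n : ℕ) : Type := EuclideanSpace ℝ (Fin n)

/-- Vector fields. -/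
abbrev VField (n : ℕ) (M : Type*) [TopologicalSpace M] [ChartedSpace (Model n) M] : Type _ :=
  (x : M) → TangentSpace (𝓡 n) x

/-- Differential `p`-forms. -/
abbrev DForm (n : ℕ) (M : Type*) [TopologicalSpace M] [ChartedSpace (Model n) M] (p : ℕ) :
    Type _ :=
  (x : M) → TangentSpace (𝓡 n) x [⋀^Fin p]→L[ℝ] ℝ

instance (x : M) : FiniteDimensional ℝ (TangentSpace (𝓡 n) x) :=
  inferInstanceAs (FiniteDimensional ℝ (EuclideanSpace ℝ (Fin n)))

instance (x : M) : Fact (finrank ℝ (TangentSpace (𝓡 n) x) = n) :=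
  ⟨(finrank_euclideanSpace_fin : finrank ℝ (EuclideanSpace ℝ (Fin n)) = n)⟩

/-- The differential `dφ_y : T_y M → ℝⁿ` of the chart `φ` around `x`. -/
def toModel (x y : M) : TangentSpace (𝓡 n) y →L[ℝ] Model n :=
  mfderiv (𝓡 n) 𝓘(ℝ, Model n) (extChartAt (𝓡 n) x) y

/-- The differential of `φ⁻¹` at the point `z ∈ ℝⁿ`, where `φ` is the chart around `x`. -/
def ofModel (x : M) (z : Model n) :
    Model n →L[ℝ] TangentSpace (𝓡 n) ((extChartAt (𝓡 n) x).symm z) :=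
  mfderiv 𝓘(ℝ, Model n) (𝓡 n) (extChartAt (𝓡 n) x).symm z

/-- A `p`-form in the chart around `x`. -/
def formInChart {p : ℕ} (α : DForm n M p) (x : M) (z : Model n) : Model n [⋀^Fin p]→L[ℝ] ℝ :=
  (α ((extChartAt (𝓡 n) x).symm z)).compContinuousLinearMap (ofModel x z)

/-- A vector field in the chart around `x`. -/
def fieldInChart (Y : VField n M) (x : M) (z : Model n) : Model n :=
  toModel x ((extChartAt (𝓡 n) x).symm z) (Y ((extChartAt (𝓡 n) x).symm z))

/-- The exterior derivative. -/
def extD {p : ℕ} (α : DForm n M p) : DForm n M (p + 1) := fun x =>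
  (extDeriv (formInChart α x) (extChartAt (𝓡 n) x x)).compContinuousLinearMap (toModel x x)

/-- An orientation of `M`: a choice of an orientation of each tangent space such that every point
has a neighbourhood with a smooth positively oriented frame. -/
structure MOrientation (n : ℕ) (M : Type*) [TopologicalSpace M] [ChartedSpace (Model n) M]
    [IsManifold (𝓡 n) ∞ M] where
  /-- The orientation of `T_x M`. -/
  orient : (x : M) → Orientation ℝ (TangentSpace (𝓡 n) x) (Fin n)
  exists_frame : ∀ x : M, ∃ U ∈ 𝓝 x, ∃ X : Fin n → VField n M,
    (∀ i, ContMDiffOn (𝓡 n) (𝓡 n).tangent ∞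
      (fun y => (⟨y, X i y⟩ : TotalSpace (Model n) (TangentSpace (𝓡 n) : M → Type _))) U) ∧
    ∀ y ∈ U, ∃ b : Basis (Fin n) ℝ (TangentSpace (𝓡 n) y),
      (∀ i, b i = X i y) ∧ b.orientation = orient y

variable [RiemannianBundle (fun x : M => TangentSpace (𝓡 n) x)]

/-- The metric `g_{ij}` in the chart around `x`, as a bilinear form depending on `z ∈ ℝⁿ`. -/
def metricInChart (x : M) (z : Model n) : Model n →L[ℝ] Model n →L[ℝ] ℝ :=
  (innerSL ℝ (E := TangentSpace (𝓡 n) ((extChartAt (𝓡 n) x).symm z))).bilinearComp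
    (ofModel x z) (ofModel x z)

/-- The Christoffel map `a ↦ Γ(a, b)` at `x` in the chart around `x`: with `g` the metric in that
chart, `⟨Γ(a, b), c⟩ = (D_a g(b, c) + D_b g(a, c) - D_c g(b, a)) / 2`. It is symmetric in `a`
and `b`. -/
def christoffel (x : M) (b : TangentSpace (𝓡 n) x) :
    TangentSpace (𝓡 n) x →L[ℝ] TangentSpace (𝓡 n) x :=
  sharpL ∘L (christoffelForm (metricInChart x) (extChartAt (𝓡 n) x x)
    (toModel x x b)).bilinearComp (toModel x x) (toModel x x)

/-- The Levi-Civita connection on vector fields: `leviCivita Y x v = (∇_v Y)(x)`, which is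
`v(Y) + Γ(v, Y)` in the chart around `x`. -/
def leviCivita (Y : VField n M) (x : M) : TangentSpace (𝓡 n) x →L[ℝ] TangentSpace (𝓡 n) x :=
  (toModel x x).inverse ∘L fderiv ℝ (fieldInChart Y x) (extChartAt (𝓡 n) x x) ∘L toModel x x
  + christoffel x (Y x)

/-- The Levi-Civita connection on `p`-forms: `covForm α x v = (∇_v α)(x)`, which is
`v(α)(X₁, …, X_p) - ∑ᵢ α(X₁, …, Γ(v, Xᵢ), …, X_p)` in the chart around `x`. -/
def covForm {p : ℕ} (α : DForm n M p) (x : M) (v : TangentSpace (𝓡 n) x) :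
    TangentSpace (𝓡 n) x [⋀^Fin p]→L[ℝ] ℝ :=
  (fderiv ℝ (formInChart α x) (extChartAt (𝓡 n) x x)
      (toModel x x v)).compContinuousLinearMap (toModel x x)
  - insertEndo (α x) (christoffel x v)

/-- The `1`-form `Ã` dual to a vector field `A`. -/
def flat (A : VField n M) : DForm n M 1 := fun x =>
  ContinuousAlternatingMap.ofSubsingleton ℝ (TangentSpace (𝓡 n) x) ℝ (0 : Fin 1)
    (innerSL ℝ (A x))

/-- The vector field `α^♯` dual to a `1`-form `α`. -/
def sharpField (α : DForm n M 1) : VField n M := fun x =>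
  sharp ((ContinuousAlternatingMap.ofSubsingleton ℝ (TangentSpace (𝓡 n) x) ℝ
    (0 : Fin 1)).symm (α x))

/-- The gradient of a function. -/
def grad (f : M → ℝ) : VField n M := fun x =>
  sharp (mfderiv (𝓡 n) 𝓘(ℝ, ℝ) f x : TangentSpace (𝓡 n) x →L[ℝ] ℝ)

/-- The divergence `div A = Trace(∇A)`. -/
def div (A : VField n M) (x : M) : ℝ :=
  LinearMap.trace ℝ (TangentSpace (𝓡 n) x) (leviCivita A x).toLinearMap

/-- The symmetric part `∇ˢA` of `∇A`. -/
def symGrad (A : VField n M) (x : M) : TangentSpace (𝓡 n) x →L[ℝ] TangentSpace (𝓡 n) x :=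
  symPart (leviCivita A x)

variable [IsManifold (𝓡 n) ∞ M]

/-- The Hodge star on forms, `p + q = n`. -/
def star (o : MOrientation n M) {p q : ℕ} (h : p + q = n) (α : DForm n M p) : DForm n M q :=
  fun x => hodgeStar (o.orient x) h (α x)

/-- The codifferential `d^* = (-1)^{n(r+1)+1} ∗ d ∗` on forms of degree `r = p + 1`; it is the
formal `L²`-adjoint of the exterior derivative. -/
def codiff (o : MOrientation n M) {p q : ℕ} (h : (p + 1) + q = n) (α : DForm n M (p + 1)) :
    DForm n M p :=
  ((-1 : ℝ) ^ (n * ((p + 1) + 1) + 1)) •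
    star o (p := q + 1) (q := p) (by omega) (extD (star o h α))

/-- The De Rham–Hodge Laplacian `□ = d d^* + d^* d` on forms of degree `p + 1`, where
`0 < p + 1 < n`. -/
def hodgeLaplacian (o : MOrientation n M) {p q : ℕ} (h : (p + 1) + (q + 1) = n)
    (α : DForm n M (p + 1)) : DForm n M (p + 1) :=
  extD (codiff o h α) + codiff o (p := p + 1) (q := q) (by omega) (extD α)

end Manifold

/-! ### The Navier–Stokes equation and the vorticity in dimension three -/

section NavierStokes

variable {M : Type*} [TopologicalSpace M] [ChartedSpace (EuclideanSpace ℝ (Fin 3)) M]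
  [RiemannianBundle (fun x : M => TangentSpace (𝓡 3) x)] [IsManifold (𝓡 3) ∞ M]

/-- `□` on `1`-forms of a three-dimensional manifold. -/
def laplacianForm (o : MOrientation 3 M) (α : DForm 3 M 1) : DForm 3 M 1 :=
  hodgeLaplacian o (p := 0) (q := 1) rfl α

/-- `□A = (□Ã)^♯` on vector fields. -/
def laplacianField (o : MOrientation 3 M) (A : VField 3 M) : VField 3 M :=
  sharpField (laplacianForm o (flat A))

/-- The vorticity `∗ dũ` of a vector field `u`. -/
def vorticity (o : MOrientation 3 M) (u : VField 3 M) : DForm 3 M 1 :=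
  star o (p := 2) (q := 1) rfl (extD (flat u))

/-- `(u, p)` is a smooth solution on the time interval `J` of
`∂ₜu + ∇_u u + ν □u = -∇p`, `div u = 0`. -/
structure IsSmoothNSSolution (o : MOrientation 3 M) (ν : ℝ) (J : Set ℝ)
    (u : ℝ → VField 3 M) (p : ℝ → M → ℝ) : Prop where
  smooth_velocity : ContMDiffOn (𝓘(ℝ, ℝ).prod (𝓡 3)) (𝓡 3).tangent ∞
    (fun z : ℝ × M =>
      (⟨z.2, u z.1 z.2⟩ : TotalSpace (Model 3) (TangentSpace (𝓡 3) : M → Type _)))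
    (J ×ˢ Set.univ)
  smooth_pressure : ∀ t ∈ J, ContMDiff (𝓡 3) 𝓘(ℝ, ℝ) ∞ (p t)
  momentum : ∀ t ∈ J, ∀ x : M,
    derivWithin (fun s => u s x) J t + leviCivita (u t) x (u t x)
      + ν • laplacianField o (u t) x = - grad (p t) x
  incompressible : ∀ t ∈ J, ∀ x : M, div (u t) x = 0

end NavierStokes

end

end NSVorticity

/-! Lower the index in the momentum equation to get ∂ₜũ + (∇_u u)^♭ + ν □ũ = -dp, then apply ∗d. The
pressure disappears because d² = 0. The time derivative passes through ∗d by symmetry of mixed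
derivatives (`hasDerivWithinAt_vorticity`).

The viscous term passes through because ∗d and □ commute on 1-forms in dimension three
(`laplacianForm_star_extD`). On 2-forms d^* = ∗d∗ and on 1-forms d^* = ±∗d∗, so d²= 0 and ∗∗ = 1
reduce both □∗dα and ∗d□α to ∗d∗d∗dα.

The advection term carries the geometry (`star_extD_flat_advection`). Let W be the vector field dual
to ω, so that dũ = vol(W, ⬝, ⬝). Since the connection is metric and torsion free, (∇_u u)^♭ = vol(W,
u, ⬝) + d(|u|²/2) (`flat_advection`), and the second term is exact. The volume form is parallel
(`fderiv_volForm_fields`), so d of vol(W, u, ⬝) is the contraction of vol with ∇_u W - ∇_W u + (div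
u) W - (div W) u. Here div u = 0 by hypothesis, and ddũ = 0 says div W = 0
(`volForm_leviCivita_vorticity`). Thus ∗d(∇_u u)^♭ is dual to ∇_u W - ∇_W u.

Finally dũ(W, ⬝) = vol(W, W, ⬝) = 0, so ⟨∇_W u, a⟩ = ⟨∇_a u, W⟩ for every a. The antisymmetric part
of ∇u therefore does not act on ω, and the dual of ∇_W u is ω ⊙ ∇ˢu.

Everything is computed in the preferred chart at the point. This needs `extD` to be independent of
the chart (`formInChart_extD`), and the fields, the metric and the volume density to be smooth in
charts. -/

namespace NSVorticity

noncomputable section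

/-! ### Hodge star and volume form of a three-dimensional oriented Euclidean space. -/

section HodgeThree

variable {V : Type*} [NormedAddCommGroup V] [InnerProductSpace ℝ V]

theorem det_toBasis_three (b : OrthonormalBasis (Fin 3) ℝ V) (x y z : V) :
    b.toBasis.det ![x, y, z] =
      inner ℝ (b 0) x * inner ℝ (b 1) y * inner ℝ (b 2) z
        - inner ℝ (b 0) x * inner ℝ (b 2) y * inner ℝ (b 1) z
        - inner ℝ (b 1) x * inner ℝ (b 0) y * inner ℝ (b 2) z
        + inner ℝ (b 2) x * inner ℝ (b 0) y * inner ℝ (b 1) z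
        + inner ℝ (b 1) x * inner ℝ (b 2) y * inner ℝ (b 0) z
        - inner ℝ (b 2) x * inner ℝ (b 1) y * inner ℝ (b 0) z := by
  rw [Basis.det_apply, Matrix.det_fin_three]
  simp only [Basis.toMatrix_apply, OrthonormalBasis.coe_toBasis_repr_apply,
    OrthonormalBasis.repr_apply_apply, Matrix.cons_val_zero, Matrix.cons_val_one, Matrix.cons_val]
  ring

variable [Fact (finrank ℝ V = 3)]

theorem contractVol_zero_three (o : Orientation ℝ V (Fin 3)) (h : 3 + 0 = 3) (a : Fin 3 → V)
    (v : Fin 0 → V) : contractVol o h a v = o.volumeForm a := by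
  change o.volumeForm _ = _
  congr 1
  funext i
  exact Fin.append_left a v i

theorem contractVol_two_one (o : Orientation ℝ V (Fin 3)) (h : 2 + 1 = 3) (a : Fin 2 → V)
    (v : Fin 1 → V) : contractVol o h a v = o.volumeForm ![a 0, a 1, v 0] := by
  change o.volumeForm _ = _
  congr 1
  funext i
  fin_cases i
  · exact Fin.append_left a v 0
  · exact Fin.append_left a v 1
  · exact Fin.append_right a v 0

theorem contractVol_one_two (o : Orientation ℝ V (Fin 3)) (h : 1 + 2 = 3) (a : Fin 1 → V)
    (v : Fin 2 → V) : contractVol o h a v = o.volumeForm ![a 0, v 0, v 1] := by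
  change o.volumeForm _ = _
  congr 1
  funext i
  fin_cases i
  · exact Fin.append_left a v 0
  · exact Fin.append_right a v 0
  · exact Fin.append_right a v 1

variable [FiniteDimensional ℝ V]

/-- An orthonormal basis, indexed by `Fin 3`, in which both the volume form and the Hodge star
have their usual expressions. -/
theorem exists_orthonormalBasis_hodgeStar (o : Orientation ℝ V (Fin 3)) :
    ∃ (b : OrthonormalBasis (Fin 3) ℝ V) (ε : ℝ), ε * ε = 1 ∧
      (∀ v, o.volumeForm v = ε * b.toBasis.det v) ∧
      ∀ (p q : ℕ) (h : p + q = 3) (β : V [⋀^Fin p]→L[ℝ] ℝ) (v : Fin q → V),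
        hodgeStar o h β v = ((p.factorial : ℝ)⁻¹) *
          ∑ f : Fin p → Fin 3, β (fun i => b (f i)) * contractVol o h (fun i => b (f i)) v := by
  have hn : finrank ℝ V = 3 := Fact.out
  -- The standard orthonormal basis need not be positively oriented; ε = ±1, its volume, records the
  -- discrepancy.
  refine ⟨(stdOrthonormalBasis ℝ V).reindex (finCongr hn),
    o.volumeForm ((stdOrthonormalBasis ℝ V).reindex (finCongr hn)).toBasis, ?_, ?_, ?_⟩
  · have := o.volumeForm_robust' ((stdOrthonormalBasis ℝ V).reindex (finCongr hn))
      ((stdOrthonormalBasis ℝ V).reindex (finCongr hn)).toBasis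
    rw [Basis.det_self, abs_one] at this
    rw [← abs_mul_abs_self, this, one_mul]
  · intro v
    have := AlternatingMap.eq_smul_basis_det
      ((stdOrthonormalBasis ℝ V).reindex (finCongr hn)).toBasis o.volumeForm
    conv_lhs => rw [this]
    simp
  · intro p q h β v
    rw [hodgeStar, ContinuousAlternatingMap.smul_apply, ContinuousAlternatingMap.sum_apply,
      smul_eq_mul]
    congr 1
    refine Fintype.sum_equiv (Equiv.arrowCongr (Equiv.refl _) (finCongr hn)) _ _ fun f => ?_
    simp [Equiv.arrowCongr]

/-- The Gram matrix is PᵀP with P the coordinate matrix of v in an orthonormal basis, and squaring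
removes the sign ε. This identity ties the volume form to the metric; both the smoothness and the
derivative of the volume density come from it. -/
theorem volumeForm_sq (o : Orientation ℝ V (Fin 3)) (v : Fin 3 → V) :
    o.volumeForm v ^ 2 = (Matrix.of fun i j => inner ℝ (v i) (v j)).det := by
  obtain ⟨b, ε, hε, hvol, -⟩ := exists_orthonormalBasis_hodgeStar o
  rw [hvol, mul_pow, sq ε, hε, one_mul, Basis.det_apply]
  have : (Matrix.of fun i j => inner ℝ (v i) (v j))
      = (b.toBasis.toMatrix v).transpose * b.toBasis.toMatrix v := by
    ext i j
    rw [Matrix.mul_apply, Matrix.of_apply, ← b.sum_inner_mul_inner]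
    refine Finset.sum_congr rfl fun k _ => ?_
    simp [Basis.toMatrix_apply, OrthonormalBasis.repr_apply_apply, real_inner_comm]
  rw [this, Matrix.det_mul, Matrix.det_transpose, sq]

theorem sum_fin_two_arrow {ι R : Type*} [Fintype ι] [AddCommMonoid R] (F : (Fin 2 → ι) → R) :
    ∑ f : Fin 2 → ι, F f = ∑ i, ∑ j, F ![i, j] := by
  rw [← Fintype.sum_prod_type' fun i j => F ![i, j]]
  exact Fintype.sum_equiv (finTwoArrowEquiv ι) _ _ fun f => congrArg F (by ext i; fin_cases i <;> rfl)

theorem sum_fin_one_arrow {ι R : Type*} [Fintype ι] [AddCommMonoid R] (F : (Fin 1 → ι) → R) :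
    ∑ f : Fin 1 → ι, F f = ∑ i, F ![i] :=
  Fintype.sum_equiv (Equiv.funUnique (Fin 1) ι) _ _ fun f =>
    congrArg F (by ext i; fin_cases i; rfl)

/-- The Hodge star of `ι_w vol` is the covector dual to `w`. -/
theorem hodgeStar_two_apply (o : Orientation ℝ V (Fin 3)) (h : 2 + 1 = 3) (β : V [⋀^Fin 2]→L[ℝ] ℝ)
    (w : V) (hβ : ∀ x y, β ![x, y] = o.volumeForm ![w, x, y]) (v : Fin 1 → V) :
    hodgeStar o h β v = inner ℝ w (v 0) := by
  obtain ⟨b, ε, hε, hvol, hstar⟩ := exists_orthonormalBasis_hodgeStar o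
  have hβ' : ∀ i j, β (fun k => b (![i, j] k)) = o.volumeForm ![w, b i, b j] := fun i j => by
    rw [← hβ]; congr 1; ext k; fin_cases k <;> rfl
  have hb := orthonormal_iff_ite.1 b.orthonormal
  -- Each unordered pair of indices occurs twice, which cancels 1/2!. The form β and the contraction
  -- each contribute a factor ε, and ε² = 1.
  rw [hstar, sum_fin_two_arrow, ← b.sum_inner_mul_inner]
  simp only [hβ',
    contractVol_two_one, hvol, det_toBasis_three, hb, Fin.sum_univ_three,
    Matrix.cons_val_zero, Matrix.cons_val_one, real_inner_comm]
  simp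
  linear_combination (inner ℝ w (b 0) * inner ℝ (v 0) (b 0) + inner ℝ w (b 1) * inner ℝ (v 0) (b 1)
    + inner ℝ w (b 2) * inner ℝ (v 0) (b 2)) * hε

theorem hodgeStar_one_apply (o : Orientation ℝ V (Fin 3)) (h : 1 + 2 = 3) (α : V [⋀^Fin 1]→L[ℝ] ℝ)
    (w : V) (hα : ∀ x, α ![x] = inner ℝ w x) (v : Fin 2 → V) :
    hodgeStar o h α v = o.volumeForm ![w, v 0, v 1] := by
  obtain ⟨b, ε, hε, hvol, hstar⟩ := exists_orthonormalBasis_hodgeStar o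
  have hα' : ∀ i, α (fun k => b (![i] k)) = inner ℝ w (b i) := fun i => by
    rw [← hα]; congr 1; ext k; fin_cases k; rfl
  have hb := orthonormal_iff_ite.1 b.orthonormal
  rw [hstar, sum_fin_one_arrow]
  simp only [hα',
    contractVol_one_two, hvol, det_toBasis_three, hb, Fin.sum_univ_three,
    Matrix.cons_val_zero, real_inner_comm]
  simp
  ring

theorem hodgeStar_three_apply (o : Orientation ℝ V (Fin 3)) (h : 3 + 0 = 3)
    (γ : V [⋀^Fin 3]→L[ℝ] ℝ) (c : ℝ) (hγ : ∀ v, γ v = c * o.volumeForm v) (v : Fin 0 → V) :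
    hodgeStar o h γ v = c := by
  obtain ⟨b, ε, hε, hvol, hstar⟩ := exists_orthonormalBasis_hodgeStar o
  rw [hstar]
  simp only [hγ,
    contractVol_zero_three]
  -- Only the six permutations contribute, each with 1, and this cancels 1/3!. Passing to integer
  -- matrices makes the sum decidable.
  have hsum : ∑ f : Fin 3 → Fin 3, b.toBasis.det (fun i => b (f i)) ^ 2 = 6 := by
    have h1 : ∀ f : Fin 3 → Fin 3, b.toBasis.det (fun i => b (f i))
        = ((Matrix.of fun i j => if i = f j then (1 : ℤ) else 0).det : ℤ) := fun f => by
      rw [Basis.det_apply, Matrix.det_fin_three, Matrix.det_fin_three]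
      simp [Basis.toMatrix_apply]
    have h2 : ∑ f : Fin 3 → Fin 3, (Matrix.of fun i j => if i = f j then (1 : ℤ) else 0).det ^ 2
      = 6 := by decide +kernel
    simp only [h1]
    exact_mod_cast h2
  have : ∀ f : Fin 3 → Fin 3, c * o.volumeForm (fun i => b (f i)) * o.volumeForm (fun i => b (f i))
      = c * b.toBasis.det (fun i => b (f i)) ^ 2 := fun f => by
    rw [hvol]; linear_combination (c * b.toBasis.det (fun i => b (f i)) ^ 2) * hε
  simp only [this]
  rw [← Finset.mul_sum, hsum]
  norm_num [Nat.factorial]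
  ring

theorem alternating_two_swap {W : Type*} [AddCommGroup W] [Module ℝ W] [TopologicalSpace W]
    (β : W [⋀^Fin 2]→L[ℝ] ℝ) (x y : W) : β ![y, x] = - β ![x, y] := by
  have h : ![y, x] = ![x, y] ∘ Equiv.swap 0 1 := by ext i; fin_cases i <;> rfl
  rw [h]
  exact β.toAlternatingMap.map_swap ![x, y] (by decide)

/-- Every `2`-form in dimension three is the contraction of the volume form with a vector. -/
theorem exists_eq_volumeForm_contract (o : Orientation ℝ V (Fin 3)) (β : V [⋀^Fin 2]→L[ℝ] ℝ) :
    ∃ w : V, ∀ x y, β ![x, y] = o.volumeForm ![w, x, y] := by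
  obtain ⟨b, ε, hε, hvol, -⟩ := exists_orthonormalBasis_hodgeStar o
  have hb := orthonormal_iff_ite.1 b.orthonormal
  -- The coordinates of w are the cyclic components of β; the factor ε cancels the one in vol(b 0, b
  -- 1, b 2) = ε.
  refine ⟨ε • (β ![b 1, b 2] • b 0 + β ![b 2, b 0] • b 1 + β ![b 0, b 1] • b 2), ?_⟩
  set w := ε • (β ![b 1, b 2] • b 0 + β ![b 2, b 0] • b 1 + β ![b 0, b 1] • b 2) with hw
  have key : ∀ i j, i ≠ j → β ![b i, b j] = o.volumeForm ![w, b i, b j] := by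
    intro i j hij
    rw [hvol, det_toBasis_three]
    have h0 : inner ℝ (b 0) w = ε * β ![b 1, b 2] := by
      simp [hw, inner_add_right, inner_smul_right, hb]
    have h1 : inner ℝ (b 1) w = ε * β ![b 2, b 0] := by
      simp [hw, inner_add_right, inner_smul_right, hb]
    have h2 : inner ℝ (b 2) w = ε * β ![b 0, b 1] := by
      simp [hw, inner_add_right, inner_smul_right, hb]
    rw [h0, h1, h2]
    fin_cases i <;> fin_cases j <;> simp [hb] at hij ⊢ <;> rw [← mul_assoc, hε, one_mul] <;>
      exact alternating_two_swap β _ _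
  have hext : β.toAlternatingMap = (contractVol o (p := 1) (q := 2) rfl ![w]).toAlternatingMap := by
    refine Basis.ext_alternating b.toBasis fun f hf => ?_
    have h := key (f 0) (f 1) (hf.ne (by decide))
    have hfe : (fun i => b.toBasis (f i)) = ![b (f 0), b (f 1)] := by
      ext i; fin_cases i <;> simp
    change β _ = contractVol o (p := 1) (q := 2) rfl ![w] _
    rw [contractVol_one_two, hfe]
    exact h
  intro x y
  have h := DFunLike.congr_fun hext ![x, y]
  change β _ = contractVol o (p := 1) (q := 2) rfl ![w] _ at h
  rw [h, contractVol_one_two]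
  rfl

end HodgeThree

/-! ### Smoothness of families of alternating forms. -/

section FiniteDimensionalForms

variable {E : Type*} [NormedAddCommGroup E] [NormedSpace ℝ E] [FiniteDimensional ℝ E]
  {p : ℕ}

instance finiteDimensional_continuousAlternatingMap : FiniteDimensional ℝ (E [⋀^Fin p]→L[ℝ] ℝ) :=
  FiniteDimensional.of_injective
    ({ toFun := fun η => η.toMultilinearMap
       map_add' := fun _ _ => rfl
       map_smul' := fun _ _ => rfl } : (E [⋀^Fin p]→L[ℝ] ℝ) →ₗ[ℝ] MultilinearMap ℝ (fun _ : Fin p => E) ℝ)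
    fun η₁ η h => by ext v; exact DFunLike.congr_fun h v

/-- A family of alternating forms is smooth if its values on constant vectors are. -/
theorem contDiffOn_alternating_iff {D : Type*} [NormedAddCommGroup D] [NormedSpace ℝ D]
    {m : WithTop ℕ∞} {s : Set D} {η : D → E [⋀^Fin p]→L[ℝ] ℝ} :
    ContDiffOn ℝ m η s ↔ ∀ v, ContDiffOn ℝ m (fun z => η z v) s := by
  refine ⟨fun h v => (ContinuousAlternatingMap.apply ℝ E ℝ v).contDiff.comp_contDiffOn h,
    fun h => ?_⟩
  let b := Module.finBasis ℝ E
  let T : (E [⋀^Fin p]→L[ℝ] ℝ) →ₗ[ℝ] ((Fin p → Fin (finrank ℝ E)) → ℝ) :=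
    { toFun := fun η f => η fun i => b (f i)
      map_add' := fun _ _ => rfl
      map_smul' := fun _ _ => rfl }
  have hT : LinearMap.ker T = ⊥ := LinearMap.ker_eq_bot.2 fun η₁ η h => by
    have : η₁.toAlternatingMap = η.toAlternatingMap :=
      Basis.ext_alternating b fun f _ => congrFun h f
    ext v
    exact DFunLike.congr_fun this v
  -- Evaluation on tuples of basis vectors is injective, so a linear left inverse rebuilds the form
  -- from finitely many scalar functions.
  obtain ⟨S, hS⟩ := T.exists_leftInverse_of_injective hT
  have hη : η = fun z => LinearMap.toContinuousLinearMap S (T (η z)) :=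
    funext fun z => (LinearMap.congr_fun hS (η z)).symm
  rw [hη]
  exact (LinearMap.toContinuousLinearMap S).contDiff.comp_contDiffOn
    (contDiffOn_pi.2 fun f => h fun i => b (f i))

end FiniteDimensionalForms

/-! ### Smooth forms and fields in charts; chart independence of d and d² = 0. -/

section Charts

variable {n : ℕ} {M : Type*} [TopologicalSpace M] [ChartedSpace (EuclideanSpace ℝ (Fin n)) M]

theorem minSmoothness_two_le : minSmoothness ℝ 2 ≤ (∞ : WithTop ℕ∞) := by
  rw [minSmoothness_of_isRCLikeNormedField]
  exact WithTop.coe_le_coe.2 le_top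

theorem isOpen_target (x : M) : IsOpen (extChartAt (𝓡 n) x).target :=
  isOpen_extChartAt_target x

/-- A form is smooth if it is smooth in every preferred chart. -/
def SmoothForm {p : ℕ} (α : DForm n M p) : Prop :=
  ∀ x : M, ContDiffOn ℝ ∞ (formInChart α x) (extChartAt (𝓡 n) x).target

/-- A vector field is smooth if it is smooth in every preferred chart. -/
def SmoothField (Y : VField n M) : Prop :=
  ∀ x : M, ContDiffOn ℝ ∞ (fieldInChart Y x) (extChartAt (𝓡 n) x).target

theorem SmoothForm.contDiffAt {p : ℕ} {α : DForm n M p} (hα : SmoothForm α) (x : M) {z : Model n}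
    (hz : z ∈ (extChartAt (𝓡 n) x).target) : ContDiffAt ℝ ∞ (formInChart α x) z :=
  (hα x).contDiffAt ((isOpen_target x).mem_nhds hz)

theorem SmoothForm.differentiableAt {p : ℕ} {α : DForm n M p} (hα : SmoothForm α) (x : M)
    {z : Model n} (hz : z ∈ (extChartAt (𝓡 n) x).target) :
    DifferentiableAt ℝ (formInChart α x) z :=
  (hα.contDiffAt x hz).differentiableAt (by simp)

theorem SmoothField.contDiffAt {Y : VField n M} (hY : SmoothField Y) (x : M) {z : Model n}
    (hz : z ∈ (extChartAt (𝓡 n) x).target) : ContDiffAt ℝ ∞ (fieldInChart Y x) z :=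
  (hY x).contDiffAt ((isOpen_target x).mem_nhds hz)

theorem extD_zero {p : ℕ} : extD (0 : DForm n M p) = 0 := by
  funext x
  have : formInChart (0 : DForm n M p) x = 0 := rfl
  rw [NSVorticity.extD, this]
  have h2 : extDeriv (0 : Model n → Model n [⋀^Fin p]→L[ℝ] ℝ) (extChartAt (𝓡 n) x x) = 0 := by
    have := extDeriv_fun_smul (𝕜 := ℝ) (x := extChartAt (𝓡 n) x x) (0 : ℝ)
      (0 : Model n → Model n [⋀^Fin p]→L[ℝ] ℝ)
    simpa using this
  rw [h2]
  rfl

theorem SmoothForm.add {p : ℕ} {α β : DForm n M p} (hα : SmoothForm α) (hβ : SmoothForm β) :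
    SmoothForm (α + β) := fun x => (hα x).add (hβ x)

theorem SmoothForm.smul {p : ℕ} {α : DForm n M p} (hα : SmoothForm α) (c : ℝ) :
    SmoothForm (c • α) := fun x => (hα x).const_smul c

theorem extD_smul {p : ℕ} (c : ℝ) (α : DForm n M p) : extD (c • α) = c • extD α := by
  funext x
  have : formInChart (c • α) x = c • formInChart α x := rfl
  rw [NSVorticity.extD, this, extDeriv_smul]
  rfl

theorem extD_add {p : ℕ} {α β : DForm n M p} (hα : SmoothForm α) (hβ : SmoothForm β) :
    extD (α + β) = extD α + extD β := by
  funext x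
  have hz := mem_extChartAt_target (I := 𝓡 n) x
  have : formInChart (α + β) x = formInChart α x + formInChart β x := rfl
  rw [NSVorticity.extD, this, extDeriv_add (hα.differentiableAt x hz) (hβ.differentiableAt x hz)]
  rfl

variable [IsManifold (𝓡 n) ∞ M]

theorem toModel_ofModel (x : M) {z : Model n} (hz : z ∈ (extChartAt (𝓡 n) x).target)
    (a : Model n) : toModel x ((extChartAt (𝓡 n) x).symm z) (ofModel x z a) = a := by
  have h := mfderiv_extChartAt_comp_mfderivWithin_extChartAt_symm (I := 𝓡 n) hz
  rw [(𝓡 n).range_eq_univ, mfderivWithin_univ] at h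
  exact DFunLike.congr_fun h a

theorem ofModel_toModel (x : M) {z : Model n} (hz : z ∈ (extChartAt (𝓡 n) x).target)
    (v : TangentSpace (𝓡 n) ((extChartAt (𝓡 n) x).symm z)) :
    ofModel x z (toModel x ((extChartAt (𝓡 n) x).symm z) v) = v := by
  have h := mfderivWithin_extChartAt_symm_comp_mfderiv_extChartAt (I := 𝓡 n) hz
  rw [(𝓡 n).range_eq_univ, mfderivWithin_univ] at h
  exact DFunLike.congr_fun h v

theorem formInChart_comp_toModel {p : ℕ} (α : DForm n M p) (x : M) {y : M}
    (hy : y ∈ (extChartAt (𝓡 n) x).source) :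
    (formInChart α x (extChartAt (𝓡 n) x y)).compContinuousLinearMap (toModel x y) = α y := by
  obtain ⟨z, hz, rfl⟩ : ∃ z ∈ (extChartAt (𝓡 n) x).target, (extChartAt (𝓡 n) x).symm z = y :=
    ⟨_, (extChartAt (𝓡 n) x).map_source hy, (extChartAt (𝓡 n) x).left_inv hy⟩
  rw [(extChartAt (𝓡 n) x).right_inv hz]
  ext v
  simp only [formInChart, ContinuousAlternatingMap.compContinuousLinearMap_apply]
  congr 1
  funext i
  exact ofModel_toModel x hz (v i)

theorem contDiffAt_transition (x y : M) {z : Model n} (hz : z ∈ (extChartAt (𝓡 n) x).target)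
    (hy : (extChartAt (𝓡 n) x).symm z ∈ (extChartAt (𝓡 n) y).source) :
    ContDiffAt ℝ ∞ (fun z' => extChartAt (𝓡 n) y ((extChartAt (𝓡 n) x).symm z')) z := by
  rw [← contMDiffAt_iff_contDiffAt]
  have h1 : ContMDiffAt 𝓘(ℝ, Model n) (𝓡 n) ∞ (extChartAt (𝓡 n) x).symm z :=
    (contMDiffOn_extChartAt_symm x).contMDiffAt ((isOpen_target x).mem_nhds hz)
  have h2 : ContMDiffAt (𝓡 n) 𝓘(ℝ, Model n) ∞ (extChartAt (𝓡 n) y)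
      ((extChartAt (𝓡 n) x).symm z) :=
    contMDiffAt_extChartAt' (by rwa [extChartAt_source] at hy)
  exact h2.comp z h1

theorem fderiv_transition (x y : M) {z : Model n} (hz : z ∈ (extChartAt (𝓡 n) x).target)
    (hy : (extChartAt (𝓡 n) x).symm z ∈ (extChartAt (𝓡 n) y).source) :
    fderiv ℝ (fun z' => extChartAt (𝓡 n) y ((extChartAt (𝓡 n) x).symm z')) z
      = (toModel y ((extChartAt (𝓡 n) x).symm z)) ∘L (ofModel x z) := by
  have h1 : ContMDiffAt 𝓘(ℝ, Model n) (𝓡 n) ∞ (extChartAt (𝓡 n) x).symm z :=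
    (contMDiffOn_extChartAt_symm x).contMDiffAt ((isOpen_target x).mem_nhds hz)
  have h2 : ContMDiffAt (𝓡 n) 𝓘(ℝ, Model n) ∞ (extChartAt (𝓡 n) y)
      ((extChartAt (𝓡 n) x).symm z) :=
    contMDiffAt_extChartAt' (by rwa [extChartAt_source] at hy)
  rw [← mfderiv_eq_fderiv]
  exact mfderiv_comp z (h2.mdifferentiableAt (by simp)) (h1.mdifferentiableAt (by simp))

/-- The exterior derivative may be computed in any chart. -/
theorem formInChart_extD {p : ℕ} {α : DForm n M p} (hα : SmoothForm α) (x : M) {z : Model n}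
    (hz : z ∈ (extChartAt (𝓡 n) x).target) :
    formInChart (extD α) x z = extDeriv (formInChart α x) z := by
  set y := (extChartAt (𝓡 n) x).symm z with hy
  have hyy : y ∈ (extChartAt (𝓡 n) y).source := mem_extChartAt_source y
  -- At y, `extD` is computed in the preferred chart of y. Near z, the form in the chart of x is the
  -- pullback of the form in the chart of y by the transition map, and the exterior derivative
  -- commutes with pullback.
  have hev : formInChart α x =ᶠ[𝓝 z] fun z' =>
      (formInChart α y (extChartAt (𝓡 n) y ((extChartAt (𝓡 n) x).symm z'))).compContinuousLinearMap
        (fderiv ℝ (fun z' => extChartAt (𝓡 n) y ((extChartAt (𝓡 n) x).symm z')) z') := by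
    have hc : ContinuousAt (extChartAt (𝓡 n) x).symm z := continuousAt_extChartAt_symm'' hz
    filter_upwards [(isOpen_target x).mem_nhds hz,
      hc.preimage_mem_nhds ((isOpen_extChartAt_source y).mem_nhds hyy)] with z' hz' hz''
    rw [fderiv_transition x y hz' hz'']
    conv_lhs => rw [formInChart, ← formInChart_comp_toModel α y hz'']
    rfl
  rw [hev.extDeriv_eq, extDeriv_pullback (r := ∞) _ (contDiffAt_transition x y hz hyy) minSmoothness_two_le,
    fderiv_transition x y hz hyy]
  · rfl
  · exact hα.differentiableAt y (mem_extChartAt_target y)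

theorem extDeriv_eventually_formInChart {p : ℕ} {α : DForm n M p} (hα : SmoothForm α) (x : M)
    {z : Model n} (hz : z ∈ (extChartAt (𝓡 n) x).target) :
    formInChart (extD α) x =ᶠ[𝓝 z] extDeriv (formInChart α x) := by
  filter_upwards [(isOpen_target x).mem_nhds hz] with z' hz'
  exact formInChart_extD hα x hz'

theorem SmoothForm.extD {p : ℕ} {α : DForm n M p} (hα : SmoothForm α) : SmoothForm (extD α) := by
  intro x
  have h : ContDiffOn ℝ ∞ (extDeriv (formInChart α x)) (extChartAt (𝓡 n) x).target := by
    have := (hα x).fderiv_of_isOpen (isOpen_target x) (m := ∞) (by simp)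
    exact (ContinuousAlternatingMap.alternatizeUncurryFinCLM ℝ (Model n) ℝ).contDiff.comp_contDiffOn this
  exact h.congr fun z hz => formInChart_extD hα x hz

/-- `d ∘ d = 0`. -/
theorem extD_extD {p : ℕ} {α : DForm n M p} (hα : SmoothForm α) : extD (extD α) = 0 := by
  funext x
  have hz := mem_extChartAt_target (I := 𝓡 n) x
  rw [NSVorticity.extD, (extDeriv_eventually_formInChart hα x hz).extDeriv_eq,
    extDeriv_extDeriv_apply (hα.contDiffAt x hz) minSmoothness_two_le]
  rfl

end Charts

/-! ### Musical isomorphisms. -/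

theorem inner_sharp {V : Type*} [NormedAddCommGroup V] [InnerProductSpace ℝ V]
    [FiniteDimensional ℝ V] (α : V →L[ℝ] ℝ) (v : V) : inner ℝ (sharp α) v = α v := by
  have : CompleteSpace V := FiniteDimensional.complete ℝ V
  exact InnerProductSpace.toDual_symm_apply

section

variable {n : ℕ} {M : Type*} [TopologicalSpace M] [ChartedSpace (EuclideanSpace ℝ (Fin n)) M]
  [RiemannianBundle (fun x : M => TangentSpace (𝓡 n) x)]

theorem metricInChart_apply (x : M) (z a b : Model n) :
    metricInChart x z a b = inner ℝ (ofModel x z a) (ofModel x z b) := rfl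

theorem metricInChart_symm (x : M) (z a b : Model n) :
    metricInChart x z a b = metricInChart x z b a := by
  rw [metricInChart_apply, metricInChart_apply, real_inner_comm]

theorem flat_apply (A : VField n M) (x : M) (v : Fin 1 → TangentSpace (𝓡 n) x) :
    flat A x v = inner ℝ (A x) (v 0) := rfl

theorem inner_sharpField (α : DForm n M 1) (x : M) (v : TangentSpace (𝓡 n) x) :
    inner ℝ (sharpField α x) v = α x ![v] := by
  rw [sharpField, inner_sharp]
  change α x _ = _
  congr 1
  ext i
  fin_cases i
  rfl

theorem flat_sharpField (α : DForm n M 1) : flat (sharpField α) = α := by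
  funext x
  ext v
  rw [flat_apply, inner_sharpField]
  congr 1
  ext i
  fin_cases i
  rfl

theorem flat_add (A B : VField n M) : flat (A + B) = flat A + flat B := by
  funext x
  ext v
  exact inner_add_left (A x) (B x) (v 0)

theorem flat_smul (c : ℝ) (A : VField n M) : flat (c • A) = c • flat A := by
  funext x
  ext v
  exact real_inner_smul_left (A x) (v 0) c

end

/-! ### Smoothness of the metric and of the musical isomorphisms. -/

section Smoothness

variable {n : ℕ} {M : Type*} [TopologicalSpace M] [ChartedSpace (EuclideanSpace ℝ (Fin n)) M]
  [IsManifold (𝓡 n) ∞ M]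

/-- Smoothness of a vector field along a map can be read off in a chart of the target. -/
theorem contMDiffOn_fieldAlong_iff {EN HN N : Type*} [NormedAddCommGroup EN] [NormedSpace ℝ EN]
    [TopologicalSpace HN] {IN : ModelWithCorners ℝ EN HN} [TopologicalSpace N] [ChartedSpace HN N]
    (x : M) {f : N → M} {v : (q : N) → TangentSpace (𝓡 n) (f q)} {s : Set N}
    (hs : Set.MapsTo f s (extChartAt (𝓡 n) x).source) :
    ContMDiffOn IN (𝓡 n).tangent ∞
        (fun q => (⟨f q, v q⟩ : TotalSpace (Model n) (TangentSpace (𝓡 n) : M → Type _))) s ↔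
      ContMDiffOn IN (𝓡 n) ∞ f s ∧
        ContMDiffOn IN 𝓘(ℝ, Model n) ∞ (fun q => toModel x (f q) (v q)) s := by
  have hs' : ∀ q ∈ s, f q ∈ (chartAt (EuclideanSpace ℝ (Fin n)) x).source := fun q hq => by
    simpa [extChartAt_source] using hs hq
  refine ((trivializationAt (Model n) (TangentSpace (𝓡 n) : M → Type _) x).contMDiffOn_iff
    fun q hq => ?_).trans (and_congr_right fun _ => contMDiffOn_congr fun q hq => ?_)
  · rw [Trivialization.mem_source]
    exact hs' q hq
  · rw [toModel, ← TangentBundle.continuousLinearMapAt_trivializationAt (hs' q hq),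
      Trivialization.continuousLinearMapAt_apply_of_mem]
    exact hs' q hq

theorem contMDiffOn_ofModel (x : M) (a : Model n) :
    ContMDiffOn 𝓘(ℝ, Model n) (𝓡 n).tangent ∞
      (fun z => (⟨(extChartAt (𝓡 n) x).symm z, ofModel x z a⟩ :
        TotalSpace (Model n) (TangentSpace (𝓡 n) : M → Type _))) (extChartAt (𝓡 n) x).target :=
  (contMDiffOn_fieldAlong_iff x fun _ hz => (extChartAt (𝓡 n) x).map_target hz).2
    ⟨contMDiffOn_extChartAt_symm x,
      contMDiffOn_const.congr fun _ hz => toModel_ofModel x hz a⟩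

theorem contDiffAt_det {D : Type*} [NormedAddCommGroup D] [NormedSpace ℝ D] {k : ℕ}
    {A : D → Matrix (Fin k) (Fin k) ℝ} {m : WithTop ℕ∞} {z : D}
    (hA : ∀ i j, ContDiffAt ℝ m (fun z => A z i j) z) : ContDiffAt ℝ m (fun z => (A z).det) z := by
  simp only [Matrix.det_apply]
  exact ContDiffAt.sum fun σ _ => (contDiffAt_prod fun i _ => hA _ _).const_smul _

variable [RiemannianBundle (fun x : M => TangentSpace (𝓡 n) x)]

theorem metricInChart_toModel (x : M) {z : Model n} (hz : z ∈ (extChartAt (𝓡 n) x).target)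
    (v w : TangentSpace (𝓡 n) ((extChartAt (𝓡 n) x).symm z)) :
    metricInChart x z (toModel x _ v) (toModel x _ w) = inner ℝ v w := by
  rw [metricInChart_apply, ofModel_toModel x hz, ofModel_toModel x hz]

theorem metricInChart_fieldInChart (Y : VField n M) (x : M) {z : Model n}
    (hz : z ∈ (extChartAt (𝓡 n) x).target) (a : Model n) :
    metricInChart x z (fieldInChart Y x z) a
      = inner ℝ (Y ((extChartAt (𝓡 n) x).symm z)) (ofModel x z a) := by
  rw [metricInChart_apply, fieldInChart, ofModel_toModel x hz]

theorem formInChart_flat (Y : VField n M) (x : M) {z : Model n}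
    (hz : z ∈ (extChartAt (𝓡 n) x).target) (v : Fin 1 → Model n) :
    formInChart (flat Y) x z v = metricInChart x z (fieldInChart Y x z) (v 0) := by
  rw [metricInChart_fieldInChart Y x hz]
  rfl

/-- Positive definiteness makes the metric injective as a map to the dual, and both spaces have the
same finite dimension. -/
theorem exists_metricInChart_equiv (x : M) {z : Model n}
    (hz : z ∈ (extChartAt (𝓡 n) x).target) :
    ∃ e : Model n ≃L[ℝ] (Model n →L[ℝ] ℝ), (e : Model n →L[ℝ] Model n →L[ℝ] ℝ) = metricInChart x z := by
  have hinj : Function.Injective (metricInChart x z) := by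
    refine (injective_iff_map_eq_zero _).2 fun a ha => ?_
    have h0 : metricInChart x z a a = 0 := by rw [ha]; rfl
    rw [metricInChart_apply, inner_self_eq_zero] at h0
    rw [← toModel_ofModel x hz a, h0, map_zero]
  have hfr : finrank ℝ (Model n) = finrank ℝ (Model n →L[ℝ] ℝ) := by
    rw [← LinearEquiv.finrank_eq
      (LinearMap.toContinuousLinearMap : (Model n →ₗ[ℝ] ℝ) ≃ₗ[ℝ] (Model n →L[ℝ] ℝ)),
      Module.finrank_linearMap, finrank_self, mul_one]
  refine ⟨(LinearEquiv.ofInjectiveOfFinrankEq (metricInChart x z).toLinearMap hinj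
    hfr).toContinuousLinearEquiv, ?_⟩
  ext a b
  rfl

variable [IsContMDiffRiemannianBundle (𝓡 n) ∞ (EuclideanSpace ℝ (Fin n))
      (fun x : M => TangentSpace (𝓡 n) x)]

theorem contDiffOn_metricInChart (x : M) :
    ContDiffOn ℝ ∞ (metricInChart x) (extChartAt (𝓡 n) x).target := by
  refine contDiffOn_clm_apply.2 fun a => contDiffOn_clm_apply.2 fun b => ?_
  rw [← contMDiffOn_iff_contDiffOn]
  exact (contMDiffOn_ofModel x a).inner_bundle (contMDiffOn_ofModel x b)

theorem contDiffAt_metricInChart (x : M) {z : Model n} (hz : z ∈ (extChartAt (𝓡 n) x).target) :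
    ContDiffAt ℝ ∞ (metricInChart x) z :=
  (contDiffOn_metricInChart x).contDiffAt ((isOpen_target x).mem_nhds hz)

theorem SmoothField.flat {Y : VField n M} (hY : SmoothField Y) : SmoothForm (flat Y) := by
  intro x
  refine contDiffOn_alternating_iff.2 fun v => ?_
  refine ContDiffOn.congr ?_ fun z hz => formInChart_flat Y x hz v
  exact ((contDiffOn_metricInChart x).clm_apply (hY x)).clm_apply contDiffOn_const

/-- In a chart, raising the index is applying the inverse of the metric, and inversion is smooth at
invertible maps. -/
theorem SmoothForm.sharpField {α : DForm n M 1} (hα : SmoothForm α) :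
    SmoothField (sharpField α) := by
  intro x z hz
  refine ContDiffAt.contDiffWithinAt ?_
  let A : Model n → Model n →L[ℝ] ℝ := fun z =>
    (ContinuousAlternatingMap.ofSubsingleton ℝ (Model n) ℝ (0 : Fin 1)).symm (formInChart α x z)
  have hA : ContDiffAt ℝ ∞ A z := by
    refine ContDiffOn.contDiffAt (contDiffOn_clm_apply.2 fun a => ?_) ((isOpen_target x).mem_nhds hz)
    exact contDiffOn_alternating_iff.1 (hα x) fun _ => a
  have hev : fieldInChart (NSVorticity.sharpField α) x =ᶠ[𝓝 z]
      fun z => ContinuousLinearMap.inverse (metricInChart x z) (A z) := by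
    filter_upwards [(isOpen_target x).mem_nhds hz] with z' hz'
    obtain ⟨e, he⟩ := exists_metricInChart_equiv x hz'
    rw [← he, ContinuousLinearMap.inverse_equiv]
    refine (e.symm_apply_eq.2 ?_).symm
    ext a
    change A z' a = (e : Model n →L[ℝ] Model n →L[ℝ] ℝ) _ a
    rw [he, metricInChart_fieldInChart _ x hz', inner_sharpField]
    change α _ _ = α _ _
    congr 1
    ext i
    fin_cases i
    rfl
  refine ContDiffAt.congr_of_eventuallyEq ?_ hev
  refine ContDiffAt.clm_apply ?_ hA
  obtain ⟨e, he⟩ := exists_metricInChart_equiv x hz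
  have hinv := contDiffAt_map_inverse (n := ∞) e
  rw [he] at hinv
  exact hinv.comp z (contDiffAt_metricInChart x hz)

end Smoothness

/-! ### The Riemannian volume form and its density. -/

section VolumeForm

theorem volumeForm_pos {V : Type*} [NormedAddCommGroup V] [InnerProductSpace ℝ V]
    [Fact (finrank ℝ V = 3)] (o : Orientation ℝ V (Fin 3)) (b : Basis (Fin 3) ℝ V)
    (hb : b.orientation = o) : 0 < o.volumeForm b := by
  have h3 : 0 < 3 := by norm_num
  have ho := o.finOrthonormalBasis_orientation h3 Fact.out
  rw [o.volumeForm_robust _ ho]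
  exact ((o.finOrthonormalBasis h3 Fact.out).toBasis.orientation_eq_iff_det_pos b).1
    (ho.trans hb.symm)

variable {M : Type*} [TopologicalSpace M] [ChartedSpace (EuclideanSpace ℝ (Fin 3)) M]
  [IsManifold (𝓡 3) ∞ M] [RiemannianBundle (fun x : M => TangentSpace (𝓡 3) x)]

/-- The Riemannian volume form. -/
def volForm (o : MOrientation 3 M) : DForm 3 M 3 := fun x =>
  contractVol (o.orient x) (p := 0) (q := 3) rfl ![]

theorem volForm_apply (o : MOrientation 3 M) (x : M) (v : Fin 3 → TangentSpace (𝓡 3) x) :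
    volForm o x v = (o.orient x).volumeForm v := by
  change (o.orient x).volumeForm _ = _
  congr 1
  funext i
  fin_cases i
  · exact Fin.append_right ![] v 0
  · exact Fin.append_right ![] v 1
  · exact Fin.append_right ![] v 2

/-- The density of the volume form in the chart around `x`. -/
def volDensity (o : MOrientation 3 M) (x : M) (z : Model 3) : ℝ :=
  formInChart (volForm o) x z (EuclideanSpace.basisFun (Fin 3) ℝ)

theorem formInChart_volForm (o : MOrientation 3 M) (x : M) (z : Model 3) (v : Fin 3 → Model 3) :
    formInChart (volForm o) x z v
      = volDensity o x z * (EuclideanSpace.basisFun (Fin 3) ℝ).toBasis.det v := by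
  have h := AlternatingMap.eq_smul_basis_det (EuclideanSpace.basisFun (Fin 3) ℝ).toBasis
    (formInChart (volForm o) x z).toAlternatingMap
  have h2 := DFunLike.congr_fun h v
  rw [AlternatingMap.smul_apply, smul_eq_mul, OrthonormalBasis.coe_toBasis] at h2
  exact h2

theorem formInChart_volForm_sq (o : MOrientation 3 M) (x : M) (z : Model 3)
    (v : Fin 3 → Model 3) : formInChart (volForm o) x z v ^ 2
      = (Matrix.of fun i j => metricInChart x z (v i) (v j)).det := by
  rw [formInChart, ContinuousAlternatingMap.compContinuousLinearMap_apply, volForm_apply,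
    volumeForm_sq]
  rfl

theorem volDensity_ne_zero (o : MOrientation 3 M) (x : M) {z : Model 3}
    (hz : z ∈ (extChartAt (𝓡 3) x).target) : volDensity o x z ≠ 0 := by
  intro h0
  set y := (extChartAt (𝓡 3) x).symm z
  let b := ((o.orient y).finOrthonormalBasis (by norm_num : 0 < 3) Fact.out).toBasis
  have hpos := volumeForm_pos (o.orient y) b ((o.orient y).finOrthonormalBasis_orientation _ _)
  have h := formInChart_volForm o x z fun i => toModel x y (b i)
  rw [h0, zero_mul, formInChart, ContinuousAlternatingMap.compContinuousLinearMap_apply,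
    volForm_apply] at h
  refine hpos.ne' (Eq.trans ?_ h)
  congr 1
  funext i
  exact (ofModel_toModel x hz _).symm

variable [IsContMDiffRiemannianBundle (𝓡 3) ∞ (EuclideanSpace ℝ (Fin 3))
      (fun x : M => TangentSpace (𝓡 3) x)]

/-- The metric determines only the square of the density; its sign comes from the orientation. On a
smooth positive frame with Gram matrix G and chart determinant D, density · D is positive with
square det G, so the density is √(det G) / D. -/
theorem contDiffAt_volDensity (o : MOrientation 3 M) (x : M) {z : Model 3}
    (hz : z ∈ (extChartAt (𝓡 3) x).target) : ContDiffAt ℝ ∞ (volDensity o x) z := by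
  set φ := extChartAt (𝓡 3) x with hφ
  obtain ⟨U, hU, X, hX, hXb⟩ := o.exists_frame (φ.symm z)
  have hc : ContinuousAt φ.symm z := continuousAt_extChartAt_symm'' hz
  have hS : φ.target ∩ φ.symm ⁻¹' U ∈ 𝓝 z :=
    Filter.inter_mem ((isOpen_target x).mem_nhds hz) (hc.preimage_mem_nhds hU)
  have hXs : ∀ i, ContDiffAt ℝ ∞ (fieldInChart (X i) x) z := fun i => by
    have h1 : ContMDiffOn (𝓡 3) (𝓡 3).tangent ∞
      (fun y => (⟨y, X i y⟩ : TotalSpace (Model 3) (TangentSpace (𝓡 3) : M → Type _)))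
        (φ.source ∩ U) := (hX i).mono Set.inter_subset_right
    have h2 := ((contMDiffOn_fieldAlong_iff x fun _ hq => hq.1).1 h1).2
    have h3 := h2.comp ((contMDiffOn_extChartAt_symm x).mono Set.inter_subset_left)
      (fun z' (hz' : z' ∈ φ.target ∩ φ.symm ⁻¹' U) => ⟨φ.map_target hz'.1, hz'.2⟩)
    exact (contMDiffOn_iff_contDiffOn.1 h3).contDiffAt hS
  let G : Model 3 → Matrix (Fin 3) (Fin 3) ℝ := fun z' => Matrix.of fun i j =>
    metricInChart x z' (fieldInChart (X i) x z') (fieldInChart (X j) x z')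
  let D : Model 3 → ℝ := fun z' =>
    (EuclideanSpace.basisFun (Fin 3) ℝ).toBasis.det fun i => fieldInChart (X i) x z'
  have hGs : ContDiffAt ℝ ∞ (fun z' => (G z').det) z := contDiffAt_det fun i j =>
    ((contDiffAt_metricInChart x hz).clm_apply (hXs i)).clm_apply (hXs j)
  have hDs : ContDiffAt ℝ ∞ D z := by
    simp only [D, Basis.det_apply]
    refine contDiffAt_det fun i j => ?_
    simp only [Basis.toMatrix_apply, OrthonormalBasis.coe_toBasis_repr_apply,
      EuclideanSpace.basisFun_repr]
    exact contDiffAt_euclidean.1 (hXs j) i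
  have key : ∀ z' ∈ φ.target ∩ φ.symm ⁻¹' U, 0 < volDensity o x z' * D z' ∧
      (volDensity o x z' * D z') ^ 2 = (G z').det := by
    intro z' hz'
    rw [← formInChart_volForm]
    refine ⟨?_, formInChart_volForm_sq o x z' _⟩
    obtain ⟨b, hb, hbo⟩ := hXb _ hz'.2
    rw [formInChart, ContinuousAlternatingMap.compContinuousLinearMap_apply, volForm_apply]
    refine (volumeForm_pos _ b hbo).trans_eq ?_
    congr 1
    funext i
    rw [hb]
    exact (ofModel_toModel x hz'.1 _).symm
  have hev : volDensity o x =ᶠ[𝓝 z] fun z' => Real.sqrt (G z').det / D z' := by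
    filter_upwards [hS] with z' hz'
    obtain ⟨h1, h2⟩ := key z' hz'
    rw [← h2, Real.sqrt_sq h1.le, mul_div_cancel_right₀]
    exact right_ne_zero_of_mul h1.ne'
  obtain ⟨h1, h2⟩ := key z (mem_of_mem_nhds hS)
  refine ContDiffAt.congr_of_eventuallyEq ?_ hev
  exact (hGs.sqrt (by rw [← h2]; positivity)).div hDs (right_ne_zero_of_mul h1.ne')

theorem contDiffOn_volDensity (o : MOrientation 3 M) (x : M) :
    ContDiffOn ℝ ∞ (volDensity o x) (extChartAt (𝓡 3) x).target :=
  fun _ hz => (contDiffAt_volDensity o x hz).contDiffWithinAt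

theorem smoothForm_volForm (o : MOrientation 3 M) : SmoothForm (volForm o) := by
  intro x
  refine contDiffOn_alternating_iff.2 fun v => ?_
  simp only [formInChart_volForm]
  exact (contDiffOn_volDensity o x).mul contDiffOn_const

end VolumeForm

/-! ### The Hodge star on fields of forms, its smoothness, and the Laplacian. -/

section StarPointwise

variable {M : Type*} [TopologicalSpace M] [ChartedSpace (EuclideanSpace ℝ (Fin 3)) M]
  [IsManifold (𝓡 3) ∞ M] [RiemannianBundle (fun x : M => TangentSpace (𝓡 3) x)]

/-- A `2`-form is the contraction of the volume form with the vector field dual to its Hodge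
star. -/
theorem apply_eq_volForm_sharpField_star (o : MOrientation 3 M) (h : 2 + 1 = 3) (β : DForm 3 M 2)
    (x : M) (v : Fin 2 → TangentSpace (𝓡 3) x) :
    β x v = volForm o x ![sharpField (star o h β) x, v 0, v 1] := by
  obtain ⟨w, hw⟩ := exists_eq_volumeForm_contract (o.orient x) (β x)
  have hW : sharpField (star o h β) x = w := by
    refine ext_inner_right ℝ fun a => ?_
    rw [inner_sharpField, star, hodgeStar_two_apply _ _ _ w hw]
    rfl
  rw [hW, volForm_apply, ← hw]
  congr 1
  ext i
  fin_cases i <;> rfl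

theorem star_one_apply (o : MOrientation 3 M) (h : 1 + 2 = 3) (α : DForm 3 M 1) (x : M)
    (v : Fin 2 → TangentSpace (𝓡 3) x) :
    star o h α x v = volForm o x ![sharpField α x, v 0, v 1] := by
  rw [volForm_apply, star]
  exact hodgeStar_one_apply _ _ _ _ (fun a => (inner_sharpField α x a).symm) v

theorem star_star_two (o : MOrientation 3 M) (h : 1 + 2 = 3) (h' : 2 + 1 = 3) (β : DForm 3 M 2) :
    star o h (star o h' β) = β := by
  funext x
  ext v
  rw [star_one_apply, apply_eq_volForm_sharpField_star o h' β]

theorem star_add (o : MOrientation 3 M) {p q : ℕ} (h : p + q = 3) (α β : DForm 3 M p) :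
    star o h (α + β) = star o h α + star o h β := by
  funext x
  simp [star, hodgeStar, add_smul, Finset.sum_add_distrib]

theorem star_smul (o : MOrientation 3 M) {p q : ℕ} (h : p + q = 3) (c : ℝ) (α : DForm 3 M p) :
    star o h (c • α) = c • star o h α := by
  funext x
  simp [star, hodgeStar, mul_smul, Finset.smul_sum, smul_comm c]

theorem star_zero (o : MOrientation 3 M) {p q : ℕ} (h : p + q = 3) :
    star o h (0 : DForm 3 M p) = 0 := by
  have := star_smul o h 0 (0 : DForm 3 M p)
  rwa [zero_smul, zero_smul] at this

end StarPointwise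

section StarSmooth

theorem det_basisFun (x y z : Model 3) :
    (EuclideanSpace.basisFun (Fin 3) ℝ).toBasis.det ![x, y, z] =
      x 0 * y 1 * z 2 - x 0 * y 2 * z 1 - x 1 * y 0 * z 2 + x 2 * y 0 * z 1
        + x 1 * y 2 * z 0 - x 2 * y 1 * z 0 := by
  simp only [det_toBasis_three, EuclideanSpace.basisFun_inner]

theorem det_basisFun_one_two (w : Model 3) :
    (EuclideanSpace.basisFun (Fin 3) ℝ).toBasis.det ![w, EuclideanSpace.basisFun (Fin 3) ℝ 1,
      EuclideanSpace.basisFun (Fin 3) ℝ 2] = w 0 := by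
  simp [det_basisFun]

theorem det_basisFun_two_zero (w : Model 3) :
    (EuclideanSpace.basisFun (Fin 3) ℝ).toBasis.det ![w, EuclideanSpace.basisFun (Fin 3) ℝ 2,
      EuclideanSpace.basisFun (Fin 3) ℝ 0] = w 1 := by
  simp [det_basisFun]

theorem det_basisFun_zero_one (w : Model 3) :
    (EuclideanSpace.basisFun (Fin 3) ℝ).toBasis.det ![w, EuclideanSpace.basisFun (Fin 3) ℝ 0,
      EuclideanSpace.basisFun (Fin 3) ℝ 1] = w 2 := by
  simp [det_basisFun]

variable {M : Type*} [TopologicalSpace M] [ChartedSpace (EuclideanSpace ℝ (Fin 3)) M]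
  [IsManifold (𝓡 3) ∞ M] [RiemannianBundle (fun x : M => TangentSpace (𝓡 3) x)]

theorem formInChart_eq_volForm_sharpField_star (o : MOrientation 3 M) (h : 2 + 1 = 3)
    (β : DForm 3 M 2) (x : M) {z : Model 3} (hz : z ∈ (extChartAt (𝓡 3) x).target)
    (v : Fin 2 → Model 3) :
    formInChart β x z v = formInChart (volForm o) x z
      ![fieldInChart (sharpField (star o h β)) x z, v 0, v 1] := by
  rw [formInChart, formInChart, ContinuousAlternatingMap.compContinuousLinearMap_apply,
    ContinuousAlternatingMap.compContinuousLinearMap_apply, apply_eq_volForm_sharpField_star o h]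
  congr 1
  funext i
  fin_cases i
  · exact (ofModel_toModel x hz _).symm
  · rfl
  · rfl

theorem formInChart_star_one (o : MOrientation 3 M) (h : 1 + 2 = 3) (α : DForm 3 M 1) (x : M)
    {z : Model 3} (hz : z ∈ (extChartAt (𝓡 3) x).target) (v : Fin 2 → Model 3) :
    formInChart (star o h α) x z v = formInChart (volForm o) x z
      ![fieldInChart (sharpField α) x z, v 0, v 1] := by
  rw [formInChart, formInChart, ContinuousAlternatingMap.compContinuousLinearMap_apply,
    ContinuousAlternatingMap.compContinuousLinearMap_apply, star_one_apply o h]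
  congr 1
  funext i
  fin_cases i
  · exact (ofModel_toModel x hz _).symm
  · rfl
  · rfl

/-- A 3-form is a function times the volume form; its star is that function, the quotient of the two
chart densities. -/
theorem formInChart_star_three (o : MOrientation 3 M) (h : 3 + 0 = 3) (γ : DForm 3 M 3) (x : M)
    {z : Model 3} (hz : z ∈ (extChartAt (𝓡 3) x).target) (v : Fin 0 → Model 3) :
    formInChart (star o h γ) x z v
      = formInChart γ x z (EuclideanSpace.basisFun (Fin 3) ℝ) / volDensity o x z := by
  rw [formInChart, ContinuousAlternatingMap.compContinuousLinearMap_apply, star]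
  refine hodgeStar_three_apply _ _ _ _ (fun w => ?_) _
  have h0 := volDensity_ne_zero o x hz
  have h1 := AlternatingMap.eq_smul_basis_det (EuclideanSpace.basisFun (Fin 3) ℝ).toBasis
    (formInChart γ x z).toAlternatingMap
  have h2 := DFunLike.congr_fun h1 fun i => toModel x _ (w i)
  rw [AlternatingMap.smul_apply, smul_eq_mul, OrthonormalBasis.coe_toBasis] at h2
  have h3 : formInChart γ x z (fun i => toModel x _ (w i)) = γ _ w := by
    rw [formInChart, ContinuousAlternatingMap.compContinuousLinearMap_apply]
    congr 1
    funext i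
    exact ofModel_toModel x hz _
  have h4 : formInChart (volForm o) x z (fun i => toModel x _ (w i)) = volForm o _ w := by
    rw [formInChart, ContinuousAlternatingMap.compContinuousLinearMap_apply]
    congr 1
    funext i
    exact ofModel_toModel x hz _
  rw [← volForm_apply, ← h4, ← h3, formInChart_volForm]
  refine (Eq.trans ?_ h2.symm).symm
  change _ = formInChart γ x z _ * _
  field_simp

variable [IsContMDiffRiemannianBundle (𝓡 3) ∞ (EuclideanSpace ℝ (Fin 3))
      (fun x : M => TangentSpace (𝓡 3) x)]

/-- Since β is the contraction of vol with this field, its chart components are the cyclic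
components of β divided by the nowhere vanishing volume density. -/
theorem SmoothForm.sharpField_star {β : DForm 3 M 2} (hβ : SmoothForm β) (o : MOrientation 3 M)
    (h : 2 + 1 = 3) : SmoothField (NSVorticity.sharpField (star o h β)) := by
  intro x
  have key : ∀ (i : Fin 3) (v : Fin 2 → Model 3),
      (∀ w : Model 3, (EuclideanSpace.basisFun (Fin 3) ℝ).toBasis.det ![w, v 0, v 1] = w i) →
      ContDiffOn ℝ ∞ (fun z => fieldInChart (NSVorticity.sharpField (star o h β)) x z i)
        (extChartAt (𝓡 3) x).target := by
    intro i v hv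
    have h1 : ContDiffOn ℝ ∞ (fun z => formInChart β x z v / volDensity o x z)
        (extChartAt (𝓡 3) x).target :=
      (contDiffOn_alternating_iff.1 (hβ x) v).div (contDiffOn_volDensity o x)
        fun z hz => volDensity_ne_zero o x hz
    refine h1.congr fun z hz => ?_
    rw [formInChart_eq_volForm_sharpField_star o h β x hz, formInChart_volForm, hv,
      mul_div_cancel_left₀ _ (volDensity_ne_zero o x hz)]
  refine contDiffOn_euclidean.2 fun i => ?_
  fin_cases i
  · exact key 0 ![_, _] det_basisFun_one_two
  · exact key 1 ![_, _] det_basisFun_two_zero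
  · exact key 2 ![_, _] det_basisFun_zero_one

theorem SmoothForm.star_two {β : DForm 3 M 2} (hβ : SmoothForm β) (o : MOrientation 3 M)
    (h : 2 + 1 = 3) : SmoothForm (star o h β) := by
  have := (hβ.sharpField_star o h).flat
  rwa [flat_sharpField] at this

theorem SmoothForm.star_one {α : DForm 3 M 1} (hα : SmoothForm α) (o : MOrientation 3 M)
    (h : 1 + 2 = 3) : SmoothForm (star o h α) := by
  intro x
  refine contDiffOn_alternating_iff.2 fun v => ?_
  have hs : ∀ i, ContDiffOn ℝ ∞ (fun z => fieldInChart (NSVorticity.sharpField α) x z i)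
      (extChartAt (𝓡 3) x).target := contDiffOn_euclidean.1 (hα.sharpField x)
  refine ContDiffOn.congr ?_ fun z hz => formInChart_star_one o h α x hz v
  simp only [formInChart_volForm, det_basisFun]
  have h0 := hs 0
  have h1 := hs 1
  have h2 := hs 2
  have hc := contDiffOn_volDensity o x
  fun_prop

theorem SmoothForm.star_three {γ : DForm 3 M 3} (hγ : SmoothForm γ) (o : MOrientation 3 M)
    (h : 3 + 0 = 3) : SmoothForm (star o h γ) := by
  intro x
  refine contDiffOn_alternating_iff.2 fun v => ?_
  refine ContDiffOn.congr ?_ fun z hz => formInChart_star_three o h γ x hz v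
  exact (contDiffOn_alternating_iff.1 (hγ x) _).div (contDiffOn_volDensity o x)
    fun z hz => volDensity_ne_zero o x hz

theorem SmoothForm.codiff_one {α : DForm 3 M 1} (hα : SmoothForm α) (o : MOrientation 3 M)
    (h : (0 + 1) + 2 = 3) : SmoothForm (codiff o h α) :=
  (((hα.star_one o h).extD).star_three o rfl).smul _

theorem SmoothForm.codiff_two {β : DForm 3 M 2} (hβ : SmoothForm β) (o : MOrientation 3 M)
    (h : (1 + 1) + 1 = 3) : SmoothForm (codiff o h β) :=
  (((hβ.star_two o h).extD).star_two o rfl).smul _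

theorem SmoothForm.laplacianForm {α : DForm 3 M 1} (hα : SmoothForm α) (o : MOrientation 3 M) :
    SmoothForm (laplacianForm o α) :=
  (hα.codiff_one o rfl).extD.add (hα.extD.codiff_two o rfl)

/-- `∗d` commutes with the De Rham–Hodge Laplacian. -/
theorem laplacianForm_star_extD {α : DForm 3 M 1} (hα : SmoothForm α) (o : MOrientation 3 M)
    (h : 2 + 1 = 3) :
    laplacianForm o (star o h (extD α)) = star o h (extD (laplacianForm o α)) := by
  -- On 1-forms d^* is a multiple of ∗d∗, and ∗∗dα = dα, so ddα = 0 appears: the curl is coclosed.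
  have hcod : codiff o (p := 0) (q := 2) rfl (star o h (extD α)) = 0 := by
    rw [codiff, star_star_two, extD_extD hα, star_zero, smul_zero]
  -- In degree two the exponent is 3·3 + 1 = 10, so the sign is +1.
  have hcod2 : ∀ β : DForm 3 M 2, codiff o (p := 1) (q := 1) rfl β = star o h (extD (star o h β)) := by
    intro β
    rw [codiff]
    norm_num
  have hlap : ∀ β : DForm 3 M 1, NSVorticity.laplacianForm o β
      = extD (codiff o (p := 0) (q := 2) rfl β) + codiff o (p := 1) (q := 1) rfl (extD β) :=
    fun _ => rfl
  rw [hlap, hlap, hcod, extD_zero, zero_add, extD_add (hα.codiff_one o rfl).extD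
    (hα.extD.codiff_two o rfl), extD_extD (hα.codiff_one o rfl), zero_add, hcod2, hcod2]

end StarSmooth

/-! ### Exterior derivative in low degree, and the Levi-Civita connection in a chart. -/

section ExtDerivLowDegree

variable {E : Type*} [NormedAddCommGroup E] [NormedSpace ℝ E]

theorem extDeriv_zero_form {η : E → E [⋀^Fin 0]→L[ℝ] ℝ} {z : E} (h : DifferentiableAt ℝ η z)
    (a : E) : extDeriv η z ![a] = fderiv ℝ (fun z => η z ![]) z a := by
  rw [extDeriv_apply h]
  simp [Matrix.empty_eq]

theorem extDeriv_one_form {η : E → E [⋀^Fin 1]→L[ℝ] ℝ} {z : E} (h : DifferentiableAt ℝ η z)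
    (a b : E) : extDeriv η z ![a, b]
      = fderiv ℝ (fun z => η z ![b]) z a - fderiv ℝ (fun z => η z ![a]) z b := by
  rw [extDeriv_apply h, Fin.sum_univ_two]
  have h0 : Fin.removeNth 0 ![a, b] = ![b] := by ext i; fin_cases i; rfl
  have h1 : Fin.removeNth 1 ![a, b] = ![a] := by ext i; fin_cases i; rfl
  rw [h0, h1]
  simp
  ring

theorem extDeriv_two_form {η : E → E [⋀^Fin 2]→L[ℝ] ℝ} {z : E} (h : DifferentiableAt ℝ η z)
    (a b c : E) : extDeriv η z ![a, b, c]
      = fderiv ℝ (fun z => η z ![b, c]) z a - fderiv ℝ (fun z => η z ![a, c]) z b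
        + fderiv ℝ (fun z => η z ![a, b]) z c := by
  rw [extDeriv_apply h, Fin.sum_univ_three]
  have h0 : Fin.removeNth 0 ![a, b, c] = ![b, c] := by ext i; fin_cases i <;> rfl
  have h1 : Fin.removeNth 1 ![a, b, c] = ![a, c] := by ext i; fin_cases i <;> rfl
  have h2 : Fin.removeNth 2 ![a, b, c] = ![a, b] := by ext i; fin_cases i <;> rfl
  rw [h0, h1, h2]
  simp
  ring

end ExtDerivLowDegree

section Connection

variable {n : ℕ} {M : Type*} [TopologicalSpace M] [ChartedSpace (EuclideanSpace ℝ (Fin n)) M]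

theorem fieldInChart_extChartAt (Y : VField n M) (x : M) {y : M}
    (hy : y ∈ (extChartAt (𝓡 n) x).source) :
    fieldInChart Y x (extChartAt (𝓡 n) x y) = toModel x y (Y y) := by
  obtain ⟨z, hz, rfl⟩ : ∃ z ∈ (extChartAt (𝓡 n) x).target, (extChartAt (𝓡 n) x).symm z = y :=
    ⟨_, (extChartAt (𝓡 n) x).map_source hy, (extChartAt (𝓡 n) x).left_inv hy⟩
  rw [(extChartAt (𝓡 n) x).right_inv hz]
  rfl

theorem fieldInChart_self (Y : VField n M) (x : M) :
    fieldInChart Y x (extChartAt (𝓡 n) x x) = toModel x x (Y x) :=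
  fieldInChart_extChartAt Y x (mem_extChartAt_source x)

theorem SmoothField.differentiableAt {Y : VField n M} (hY : SmoothField Y) (x : M) :
    DifferentiableAt ℝ (fieldInChart Y x) (extChartAt (𝓡 n) x x) :=
  (hY.contDiffAt x (mem_extChartAt_target x)).differentiableAt (by simp)

section

variable [RiemannianBundle (fun x : M => TangentSpace (𝓡 n) x)]

theorem inner_christoffel (x : M) (a b c : TangentSpace (𝓡 n) x) :
    inner ℝ (christoffel x b a) c = 2⁻¹ *
      (fderiv ℝ (metricInChart x) (extChartAt (𝓡 n) x x) (toModel x x a) (toModel x x b)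
          (toModel x x c)
        + fderiv ℝ (metricInChart x) (extChartAt (𝓡 n) x x) (toModel x x b) (toModel x x a)
          (toModel x x c)
        - fderiv ℝ (metricInChart x) (extChartAt (𝓡 n) x x) (toModel x x c) (toModel x x b)
          (toModel x x a)) :=
  inner_sharp _ _

end

variable [IsManifold (𝓡 n) ∞ M]

theorem formInChart_self {p : ℕ} (α : DForm n M p) (x : M) (v : Fin p → TangentSpace (𝓡 n) x) :
    formInChart α x (extChartAt (𝓡 n) x x) (fun i => toModel x x (v i)) = α x v := by
  conv_rhs => rw [← formInChart_comp_toModel α x (mem_extChartAt_source x)]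
  rfl

theorem toModel_inverse (x : M) (a : Model n) :
    toModel x x ((toModel (n := n) x x).inverse a) = a := by
  have h : (toModel (n := n) x x).IsInvertible := by
    rw [toModel]
    exact isInvertible_mfderiv_extChartAt (I := 𝓡 n) (mem_extChartAt_source x)
  exact DFunLike.congr_fun h.self_comp_inverse a

variable [RiemannianBundle (fun x : M => TangentSpace (𝓡 n) x)]

theorem metricInChart_extChartAt (x : M) {y : M} (hy : y ∈ (extChartAt (𝓡 n) x).source)
    (v w : TangentSpace (𝓡 n) y) :
    metricInChart x (extChartAt (𝓡 n) x y) (toModel x y v) (toModel x y w) = inner ℝ v w := by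
  obtain ⟨z, hz, rfl⟩ : ∃ z ∈ (extChartAt (𝓡 n) x).target, (extChartAt (𝓡 n) x).symm z = y :=
    ⟨_, (extChartAt (𝓡 n) x).map_source hy, (extChartAt (𝓡 n) x).left_inv hy⟩
  rw [(extChartAt (𝓡 n) x).right_inv hz]
  exact metricInChart_toModel x hz v w

theorem metricInChart_self (x : M) (v w : TangentSpace (𝓡 n) x) :
    metricInChart x (extChartAt (𝓡 n) x x) (toModel x x v) (toModel x x w) = inner ℝ v w :=
  metricInChart_extChartAt x (mem_extChartAt_source x) v w

theorem toModel_leviCivita (Y : VField n M) (x : M) (v : TangentSpace (𝓡 n) x) :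
    toModel x x (leviCivita Y x v) = fderiv ℝ (fieldInChart Y x) (extChartAt (𝓡 n) x x)
      (toModel x x v) + toModel x x (christoffel x (Y x) v) := by
  rw [leviCivita, add_apply, map_add]
  congr 1
  exact toModel_inverse x _

theorem flat_eventuallyEq (Y : VField n M) (x : M) (v : Fin 1 → Model n) :
    (fun z => formInChart (flat Y) x z v) =ᶠ[𝓝 (extChartAt (𝓡 n) x x)]
      fun z => metricInChart x z (fieldInChart Y x z) (v 0) := by
  filter_upwards [(isOpen_target x).mem_nhds (mem_extChartAt_target x)] with z hz
  exact formInChart_flat Y x hz v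

variable [IsContMDiffRiemannianBundle (𝓡 n) ∞ (EuclideanSpace ℝ (Fin n))
      (fun x : M => TangentSpace (𝓡 n) x)]

theorem differentiableAt_metricInChart (x : M) :
    DifferentiableAt ℝ (metricInChart (n := n) x) (extChartAt (𝓡 n) x x) :=
  (contDiffAt_metricInChart x (mem_extChartAt_target x)).differentiableAt (by simp)

/-- The derivative of the metric, evaluated on vector fields, in the chart around `x`. -/
theorem fderiv_metricInChart_apply (x : M) {A B : Model n → Model n}
    (hA : DifferentiableAt ℝ A (extChartAt (𝓡 n) x x))
    (hB : DifferentiableAt ℝ B (extChartAt (𝓡 n) x x)) (a : Model n) :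
    fderiv ℝ (fun z => metricInChart x z (A z) (B z)) (extChartAt (𝓡 n) x x) a
      = fderiv ℝ (metricInChart x) (extChartAt (𝓡 n) x x) a
          (A (extChartAt (𝓡 n) x x)) (B (extChartAt (𝓡 n) x x))
        + metricInChart x (extChartAt (𝓡 n) x x) (fderiv ℝ A (extChartAt (𝓡 n) x x) a)
          (B (extChartAt (𝓡 n) x x))
        + metricInChart x (extChartAt (𝓡 n) x x) (A (extChartAt (𝓡 n) x x))
          (fderiv ℝ B (extChartAt (𝓡 n) x x) a) := by
  have hg := differentiableAt_metricInChart (n := n) x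
  rw [fderiv_clm_apply (hg.clm_apply hA) hB, fderiv_clm_apply hg hA]
  simp
  ring

theorem fderiv_metricInChart_symm (x : M) (a b c : Model n) :
    fderiv ℝ (metricInChart x) (extChartAt (𝓡 n) x x) a b c
      = fderiv ℝ (metricInChart x) (extChartAt (𝓡 n) x x) a c b := by
  have h := fun b c : Model n => fderiv_metricInChart_apply (n := n) x (A := fun _ => b) (B := fun _ => c)
    (differentiableAt_const b) (differentiableAt_const c) a
  simp only [fderiv_fun_const, Pi.zero_apply, zero_apply, map_zero,
    add_zero] at h
  rw [← h, ← h]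
  simp only [metricInChart_symm x _ b c]

/-- The Christoffel map is symmetric: the connection is torsion free. -/
theorem christoffel_symm (x : M) (a b : TangentSpace (𝓡 n) x) :
    christoffel x a b = christoffel x b a := by
  refine ext_inner_right ℝ fun c => ?_
  rw [inner_christoffel, inner_christoffel, fderiv_metricInChart_symm x (toModel x x c)]
  ring

/-- The connection is metric. -/
theorem fderiv_metricInChart_eq (x : M) (a b c : TangentSpace (𝓡 n) x) :
    fderiv ℝ (metricInChart x) (extChartAt (𝓡 n) x x) (toModel x x a) (toModel x x b)
        (toModel x x c)
      = inner ℝ (christoffel x a b) c + inner ℝ b (christoffel x a c) := by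
  rw [real_inner_comm _ b, inner_christoffel, inner_christoffel,
    fderiv_metricInChart_symm x _ (toModel x x c) (toModel x x b),
    fderiv_metricInChart_symm x (toModel x x c),
    fderiv_metricInChart_symm x (toModel x x b)]
  ring

/-- Product rule for ⟨Y, b⟩ with b constant in the chart: the covariant derivative of such a b along
a is Γ(a, b). That last term is symmetric in a and b, so it drops out of dỸ. -/
theorem fderiv_flat {Y : VField n M} (hY : SmoothField Y) (x : M) (a b : TangentSpace (𝓡 n) x) :
    fderiv ℝ (fun z => formInChart (flat Y) x z ![toModel x x b]) (extChartAt (𝓡 n) x x)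
        (toModel x x a)
      = inner ℝ (leviCivita Y x a) b + inner ℝ (Y x) (christoffel x a b) := by
  rw [(flat_eventuallyEq Y x _).fderiv_eq,
    fderiv_metricInChart_apply x (hY.differentiableAt x) (differentiableAt_const _),
    fieldInChart_self]
  simp only [fderiv_fun_const, Pi.zero_apply, zero_apply, map_zero,
    add_zero, Matrix.cons_val_fin_one]
  rw [fderiv_metricInChart_eq, ← metricInChart_self x (leviCivita Y x a), toModel_leviCivita,
    map_add, add_apply, metricInChart_self, christoffel_symm x a]
  ring

/-- `dỸ(a, b) = ⟨∇_a Y, b⟩ - ⟨∇_b Y, a⟩`. -/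
theorem extD_flat_apply {Y : VField n M} (hY : SmoothField Y) (x : M)
    (a b : TangentSpace (𝓡 n) x) :
    extD (flat Y) x ![a, b] = inner ℝ (leviCivita Y x a) b - inner ℝ (leviCivita Y x b) a := by
  have h : extD (flat Y) x ![a, b] = extDeriv (formInChart (flat Y) x) (extChartAt (𝓡 n) x x)
      ![toModel x x a, toModel x x b] := by
    rw [extD, ContinuousAlternatingMap.compContinuousLinearMap_apply]
    congr 1
    ext i
    fin_cases i <;> rfl
  rw [h, extDeriv_one_form (hY.flat.differentiableAt x (mem_extChartAt_target x)), fderiv_flat hY,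
    fderiv_flat hY, christoffel_symm x a b]
  ring

/-- `∇_v Ỹ` is the `1`-form dual to `∇_v Y`. -/
theorem covForm_flat_apply {Y : VField n M} (hY : SmoothField Y) (x : M)
    (a : TangentSpace (𝓡 n) x) (b : Fin 1 → TangentSpace (𝓡 n) x) :
    covForm (flat Y) x a b = inner ℝ (leviCivita Y x a) (b 0) := by
  have h1 : fderiv ℝ (formInChart (flat Y) x) (extChartAt (𝓡 n) x x) (toModel x x a)
      (fun i => toModel x x (b i)) = inner ℝ (leviCivita Y x a) (b 0)
        + inner ℝ (Y x) (christoffel x a (b 0)) := by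
    rw [← fderiv_flat hY]
    have h2 : (fun i => toModel x x (b i)) = ![toModel x x (b 0)] := by
      ext i; fin_cases i; rfl
    rw [h2, fderiv_continuousAlternatingMap_apply_const
      (hY.flat.differentiableAt x (mem_extChartAt_target x))]
    rfl
  have h2 : insertEndo (flat Y x) (christoffel x a) b = inner ℝ (Y x) (christoffel x a (b 0)) := by
    change ∑ i, flat Y x (Function.update b i (christoffel x a (b i))) = _
    rw [Fin.sum_univ_one, flat_apply, Function.update_self]
  rw [covForm, ContinuousAlternatingMap.sub_apply, h2]
  change fderiv ℝ (formInChart (flat Y) x) (extChartAt (𝓡 n) x x) (toModel x x a)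
    (fun i => toModel x x (b i)) - _ = _
  rw [h1]
  ring

end Connection

/-! ### Traces, determinants and the parallel volume form. -/

section AlternatingThree

/-- A linear endomorphism acts on the top exterior power as a derivation through its trace. -/
theorem alternating_three_trace {V : Type*} [AddCommGroup V] [Module ℝ V]
    (b : Basis (Fin 3) ℝ V) (f : V [⋀^Fin 3]→ₗ[ℝ] ℝ) (A : V →ₗ[ℝ] V) (x y z : V) :
    f ![A x, y, z] + f ![x, A y, z] + f ![x, y, A z]
      = LinearMap.trace ℝ V A * f ![x, y, z] := by
  have hf : ∀ v, f v = f b * b.det v := fun v => by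
    have := DFunLike.congr_fun (AlternatingMap.eq_smul_basis_det b f) v
    simpa using this
  have hA : ∀ v i, b.repr (A v) i = ∑ j, LinearMap.toMatrix b b A i j * b.repr v j := fun v i => by
    rw [← LinearMap.toMatrix_mulVec_repr b b A v]
    rfl
  have hdet : ∀ x y z : V, b.det ![x, y, z] =
      b.repr x 0 * b.repr y 1 * b.repr z 2 - b.repr x 0 * b.repr y 2 * b.repr z 1
        - b.repr x 1 * b.repr y 0 * b.repr z 2 + b.repr x 2 * b.repr y 0 * b.repr z 1
        + b.repr x 1 * b.repr y 2 * b.repr z 0 - b.repr x 2 * b.repr y 1 * b.repr z 0 := by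
    intro x y z
    rw [Basis.det_apply, Matrix.det_fin_three]
    simp only [Basis.toMatrix_apply, Matrix.cons_val_zero, Matrix.cons_val_one, Matrix.cons_val]
    ring
  rw [hf, hf ![x, A y, z], hf ![x, y, A z], hf ![x, y, z], LinearMap.trace_eq_matrix_trace ℝ b,
    Matrix.trace_fin_three]
  simp only [hdet, hA, Fin.sum_univ_three]
  ring

theorem update_three_zero {V : Type*} (x y z w : V) :
    Function.update ![x, y, z] 0 w = ![w, y, z] := by
  ext i; fin_cases i <;> rfl

theorem update_three_one {V : Type*} (x y z w : V) :
    Function.update ![x, y, z] 1 w = ![x, w, z] := by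
  ext i; fin_cases i <;> rfl

theorem update_three_two {V : Type*} (x y z w : V) :
    Function.update ![x, y, z] 2 w = ![x, y, w] := by
  ext i; fin_cases i <;> rfl

section

variable {V : Type*} [AddCommGroup V] [Module ℝ V] [TopologicalSpace V]
  (f : V [⋀^Fin 3]→L[ℝ] ℝ) (x y z w : V)

theorem alternating_three_sub_zero : f ![x - w, y, z] = f ![x, y, z] - f ![w, y, z] := by
  have h := f.map_update_sub ![x, y, z] 0 x w
  simpa only [update_three_zero] using h

theorem alternating_three_sub_one : f ![x, y - w, z] = f ![x, y, z] - f ![x, w, z] := by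
  have h := f.map_update_sub ![x, y, z] 1 y w
  simpa only [update_three_one] using h

theorem alternating_three_sub_two : f ![x, y, z - w] = f ![x, y, z] - f ![x, y, w] := by
  have h := f.map_update_sub ![x, y, z] 2 z w
  simpa only [update_three_two] using h

theorem alternating_three_swap_right : f ![x, z, y] = - f ![x, y, z] := by
  have h : ![x, z, y] = ![x, y, z] ∘ Equiv.swap 1 2 := by ext i; fin_cases i <;> rfl
  rw [h]
  exact f.toAlternatingMap.map_swap ![x, y, z] (by decide)

end

/-- Jacobi's formula at the identity matrix: every non-diagonal product contains at least two
factors vanishing at t. It is applied to the Gram matrix of an orthonormal basis. -/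
theorem hasDerivAt_det_of_eq_one {q : Fin 3 → Fin 3 → ℝ → ℝ} {d : Fin 3 → Fin 3 → ℝ} {t : ℝ}
    (hq : ∀ i j, HasDerivAt (q i j) (d i j) t) (h1 : ∀ i j, q i j t = if i = j then 1 else 0) :
    HasDerivAt (fun s => (Matrix.of fun i j => q i j s).det) (∑ i, d i i) t := by
  simp only [Matrix.det_fin_three, Matrix.of_apply]
  have h := ((((((hq 0 0).mul (hq 1 1)).mul (hq 2 2)).sub
    (((hq 0 0).mul (hq 1 2)).mul (hq 2 1))).sub
    (((hq 0 1).mul (hq 1 0)).mul (hq 2 2))).add (((hq 0 1).mul (hq 1 2)).mul (hq 2 0))).add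
    (((hq 0 2).mul (hq 1 0)).mul (hq 2 1)) |>.sub (((hq 0 2).mul (hq 1 1)).mul (hq 2 0))
  refine h.congr_deriv ?_
  simp [h1, Fin.sum_univ_three]

end AlternatingThree

section VolumeDerivative

variable {M : Type*} [TopologicalSpace M] [ChartedSpace (EuclideanSpace ℝ (Fin 3)) M]
  [RiemannianBundle (fun x : M => TangentSpace (𝓡 3) x)]

/-- `A` represents, in the chart around `x`, a field with value `A₀` at `x` whose covariant
derivative at `x` in the direction `a` is `A'`. -/
structure HasCovDerivInChart (x : M) (a : TangentSpace (𝓡 3) x) (A : Model 3 → Model 3)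
    (A₀ A' : TangentSpace (𝓡 3) x) : Prop where
  differentiableAt : DifferentiableAt ℝ A (extChartAt (𝓡 3) x x)
  value : A (extChartAt (𝓡 3) x x) = toModel x x A₀
  deriv : fderiv ℝ A (extChartAt (𝓡 3) x x) (toModel x x a) + toModel x x (christoffel x a A₀)
    = toModel x x A'

theorem hasCovDerivInChart_const (x : M) (a b : TangentSpace (𝓡 3) x) :
    HasCovDerivInChart x a (fun _ => toModel x x b) b (christoffel x a b) :=
  ⟨differentiableAt_const _, rfl, by simp⟩

variable [IsManifold (𝓡 3) ∞ M] [IsContMDiffRiemannianBundle (𝓡 3) ∞ (EuclideanSpace ℝ (Fin 3))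
      (fun x : M => TangentSpace (𝓡 3) x)]

theorem SmoothField.hasCovDerivInChart {Y : VField 3 M} (hY : SmoothField Y) (x : M)
    (a : TangentSpace (𝓡 3) x) :
    HasCovDerivInChart x a (fieldInChart Y x) (Y x) (leviCivita Y x a) :=
  ⟨hY.differentiableAt x, fieldInChart_self Y x, by
    rw [toModel_leviCivita, christoffel_symm x a]⟩

/-- Differentiate vol(b)² = det(Gram matrix) along a, for vectors b constant in the chart and
orthonormal at x. Metric compatibility makes the derivative of the Gram matrix the symmetrization of
Γ(a, ⬝), so the right side gives 2 tr Γ(a, ⬝), while the left gives 2 vol(b) vol'(b) with vol(b)² =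
1. One basis suffices, top forms being proportional. -/
theorem fderiv_volForm (o : MOrientation 3 M) (x : M) (a : TangentSpace (𝓡 3) x)
    (v : Fin 3 → TangentSpace (𝓡 3) x) :
    fderiv ℝ (formInChart (volForm o) x) (extChartAt (𝓡 3) x x) (toModel x x a)
        (fun i => toModel x x (v i))
      = LinearMap.trace ℝ _ (christoffel x a).toLinearMap * volForm o x v := by
  obtain ⟨b, -⟩ := exists_orthonormalBasis_hodgeStar (o.orient x)
  set z₀ := extChartAt (𝓡 3) x x with hz₀
  set μ' : TangentSpace (𝓡 3) x [⋀^Fin 3]→L[ℝ] ℝ :=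
    (fderiv ℝ (formInChart (volForm o) x) z₀ (toModel x x a)).compContinuousLinearMap
      (toModel x x) with hμ'
  have hext : ∀ (f : TangentSpace (𝓡 3) x [⋀^Fin 3]→L[ℝ] ℝ), f v = f b * b.toBasis.det v := by
    intro f
    have := DFunLike.congr_fun (AlternatingMap.eq_smul_basis_det b.toBasis f.toAlternatingMap) v
    rw [AlternatingMap.smul_apply, smul_eq_mul, OrthonormalBasis.coe_toBasis] at this
    exact this
  have hb := orthonormal_iff_ite.1 b.orthonormal
  have hsq : volForm o x b ^ 2 = 1 := by
    rw [volForm_apply, volumeForm_sq]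
    simp only [hb]
    rw [show (Matrix.of fun i j : Fin 3 => if i = j then (1 : ℝ) else 0) = 1 from by
      ext i j; simp [Matrix.one_apply], Matrix.det_one]
  have hline : HasDerivAt (fun s : ℝ => z₀ + s • toModel x x a) (toModel x x a) 0 := by
    simpa using ((hasDerivAt_id (0 : ℝ)).smul_const (toModel x x a)).const_add z₀
  have hline0 : z₀ + (0 : ℝ) • toModel x x a = z₀ := by simp
  have hμd : DifferentiableAt ℝ (formInChart (volForm o) x) z₀ :=
    (smoothForm_volForm o).differentiableAt x (mem_extChartAt_target x)
  have hl : HasDerivAt (fun s : ℝ => formInChart (volForm o) x (z₀ + s • toModel x x a)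
      (fun i => toModel x x (b i))) (μ' b) 0 := by
    have h1 := hμd.hasFDerivAt.continuousAlternatingMap_apply_const (fun i => toModel x x (b i))
    exact h1.comp_hasDerivAt_of_eq (0 : ℝ) hline hline0.symm
  have hr := hasDerivAt_det_of_eq_one (t := 0)
    (q := fun i j s => metricInChart x (z₀ + s • toModel x x a) (toModel x x (b i))
      (toModel x x (b j)))
    (d := fun i j => inner ℝ (christoffel x a (b i)) (b j) + inner ℝ (b i) (christoffel x a (b j)))
    (fun i j => by
      have h0 := differentiableAt_metricInChart (n := 3) x
      have h1 : HasFDerivAt (fun z => metricInChart x z (toModel x x (b i)) (toModel x x (b j)))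
          (((fderiv ℝ (metricInChart x) z₀).flip (toModel x x (b i))).flip (toModel x x (b j)))
          z₀ := by
        have h2 := (h0.hasFDerivAt.clm_apply (hasFDerivAt_const (toModel x x (b i)) z₀)).clm_apply
          (hasFDerivAt_const (toModel x x (b j)) z₀)
        refine h2.congr_fderiv ?_
        ext w
        simp [hz₀]
      have h3 := h1.comp_hasDerivAt_of_eq (0 : ℝ) hline hline0.symm
      refine h3.congr_deriv ?_
      exact fderiv_metricInChart_eq x a (b i) (b j))
    (fun i j => by
      rw [hline0, metricInChart_self, hb])
  have hkey : 2 * volForm o x b * μ' b = 2 * LinearMap.trace ℝ _ (christoffel x a).toLinearMap := by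
    have h1 := hl.pow 2
    have h2 : HasDerivAt _ _ (0 : ℝ) := hr.congr_of_eventuallyEq (f₁ := fun s : ℝ =>
      formInChart (volForm o) x (z₀ + s • toModel x x a) (fun i => toModel x x (b i)) ^ 2)
      (Filter.Eventually.of_forall fun s => formInChart_volForm_sq o x _ _)
    have h3 := h1.unique h2
    rw [hline0, formInChart_self] at h3
    rw [LinearMap.trace_eq_sum_inner _ b]
    simp only [real_inner_comm (b _)] at h3
    simp only [Fin.sum_univ_three, ContinuousLinearMap.coe_coe] at h3 ⊢
    norm_num at h3
    linear_combination h3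
  have hμb : μ' b = LinearMap.trace ℝ _ (christoffel x a).toLinearMap * volForm o x b := by
    linear_combination (volForm o x b / 2) * hkey - μ' b * hsq
  change μ' v = _
  rw [hext μ', hext (volForm o x), hμb, mul_assoc]

/-- The volume form is parallel. -/
theorem fderiv_volForm_fields (o : MOrientation 3 M) (x : M) (a : TangentSpace (𝓡 3) x)
    {A B C : Model 3 → Model 3} {A₀ A' B₀ B' C₀ C' : TangentSpace (𝓡 3) x}
    (hA : HasCovDerivInChart x a A A₀ A') (hB : HasCovDerivInChart x a B B₀ B')
    (hC : HasCovDerivInChart x a C C₀ C') :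
    fderiv ℝ (fun z => formInChart (volForm o) x z ![A z, B z, C z]) (extChartAt (𝓡 3) x x)
        (toModel x x a)
      = volForm o x ![A', B₀, C₀] + volForm o x ![A₀, B', C₀] + volForm o x ![A₀, B₀, C'] := by
  set z₀ := extChartAt (𝓡 3) x x with hz₀
  have hfun : (fun z => formInChart (volForm o) x z ![A z, B z, C z])
      = fun z => formInChart (volForm o) x z fun i => ![A, B, C] i z := by
    funext z
    congr 1
    ext i
    fin_cases i <;> rfl
  have hd : ∀ i, DifferentiableAt ℝ (![A, B, C] i) z₀ := by
    intro i
    fin_cases i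
    exacts [hA.differentiableAt, hB.differentiableAt, hC.differentiableAt]
  have hself : ∀ X Y Z : TangentSpace (𝓡 3) x, formInChart (volForm o) x z₀
      ![toModel x x X, toModel x x Y, toModel x x Z] = volForm o x ![X, Y, Z] := by
    intro X Y Z
    rw [← formInChart_self]
    congr 1
    ext i
    fin_cases i <;> rfl
  have hval : (fun i => ![A, B, C] i z₀) = fun i => toModel x x (![A₀, B₀, C₀] i) := by
    funext i
    fin_cases i
    exacts [hA.value, hB.value, hC.value]
  have hval' : (fun i => toModel x x (![A₀, B₀, C₀] i))
      = ![toModel x x A₀, toModel x x B₀, toModel x x C₀] := by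
    funext i
    fin_cases i <;> rfl
  have hA' := eq_sub_of_add_eq hA.deriv
  have hB' := eq_sub_of_add_eq hB.deriv
  have hC' := eq_sub_of_add_eq hC.deriv
  rw [← map_sub] at hA' hB' hC'
  have h0 := update_three_zero (toModel x x A₀) (toModel x x B₀) (toModel x x C₀)
  have h1 := update_three_one (toModel x x A₀) (toModel x x B₀) (toModel x x C₀)
  have h2 := update_three_two (toModel x x A₀) (toModel x x B₀) (toModel x x C₀)
  rw [hfun, fderiv_continuousAlternatingMap_apply_apply
    ((smoothForm_volForm o).differentiableAt x (mem_extChartAt_target x)) hd, Fin.sum_univ_three,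
    hval, fderiv_volForm, hval', h0, h1, h2]
  simp only [Matrix.cons_val_zero, Matrix.cons_val_one, Matrix.cons_val]
  rw [hA', hB', hC', hself, hself, hself]
  -- The density contributes tr Γ(a, ⬝) · vol(A₀, B₀, C₀). By the trace identity this is the sum of
  -- the three terms with Γ(a, ⬝) in one slot, exactly what turns ordinary derivatives of the fields
  -- into covariant ones.
  have htr := alternating_three_trace (V := TangentSpace (𝓡 3) x)
    ((o.orient x).finOrthonormalBasis (by norm_num : 0 < 3) Fact.out).toBasis
    (volForm o x).toAlternatingMap (christoffel x a).toLinearMap A₀ B₀ C₀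
  simp only [ContinuousAlternatingMap.coe_toAlternatingMap, ContinuousLinearMap.coe_coe] at htr
  rw [← htr, alternating_three_sub_zero, alternating_three_sub_one, alternating_three_sub_two]
  ring

end VolumeDerivative

/-! ### The curl of the advection term. -/

section Advection

variable {M : Type*} [TopologicalSpace M] [ChartedSpace (EuclideanSpace ℝ (Fin 3)) M]
  [RiemannianBundle (fun x : M => TangentSpace (𝓡 3) x)]

/-- The function `|u|² / 2`. -/
def kineticEnergy (u : VField 3 M) : DForm 3 M 0 := fun x =>
  ContinuousAlternatingMap.constOfIsEmpty ℝ (TangentSpace (𝓡 3) x) (Fin 0)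
    (2⁻¹ * inner ℝ (u x) (u x))

variable [IsManifold (𝓡 3) ∞ M]

/-- The `1`-form `vol(w, u, ⬝)`. -/
def crossForm (o : MOrientation 3 M) (w u : VField 3 M) : DForm 3 M 1 := fun x =>
  ContinuousAlternatingMap.ofSubsingleton ℝ (TangentSpace (𝓡 3) x) ℝ (0 : Fin 1)
    (LinearMap.toContinuousLinearMap
      ((volForm o x).toMultilinearMap.toLinearMap ![w x, u x, 0] 2))

theorem crossForm_apply (o : MOrientation 3 M) (w u : VField 3 M) (x : M)
    (v : Fin 1 → TangentSpace (𝓡 3) x) :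
    crossForm o w u x v = volForm o x ![w x, u x, v 0] := by
  change volForm o x (Function.update _ 2 _) = _
  rw [update_three_two]

theorem formInChart_kineticEnergy (u : VField 3 M) (x : M) {z : Model 3}
    (hz : z ∈ (extChartAt (𝓡 3) x).target) (v : Fin 0 → Model 3) :
    formInChart (kineticEnergy u) x z v
      = 2⁻¹ * metricInChart x z (fieldInChart u x z) (fieldInChart u x z) := by
  rw [metricInChart_fieldInChart u x hz, fieldInChart, ofModel_toModel x hz]
  rfl

theorem formInChart_crossForm (o : MOrientation 3 M) (w u : VField 3 M) (x : M) {z : Model 3}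
    (hz : z ∈ (extChartAt (𝓡 3) x).target) (v : Fin 1 → Model 3) :
    formInChart (crossForm o w u) x z v
      = formInChart (volForm o) x z ![fieldInChart w x z, fieldInChart u x z, v 0] := by
  rw [formInChart, formInChart, ContinuousAlternatingMap.compContinuousLinearMap_apply,
    ContinuousAlternatingMap.compContinuousLinearMap_apply, crossForm_apply]
  congr 1
  funext i
  fin_cases i
  · exact (ofModel_toModel x hz _).symm
  · exact (ofModel_toModel x hz _).symm
  · rfl

variable [IsContMDiffRiemannianBundle (𝓡 3) ∞ (EuclideanSpace ℝ (Fin 3))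
      (fun x : M => TangentSpace (𝓡 3) x)]

theorem SmoothField.kineticEnergy {u : VField 3 M} (hu : SmoothField u) :
    SmoothForm (kineticEnergy u) := by
  intro x
  refine contDiffOn_alternating_iff.2 fun v => ?_
  refine ContDiffOn.congr ?_ fun z hz => formInChart_kineticEnergy u x hz v
  exact contDiffOn_const.mul (((contDiffOn_metricInChart x).clm_apply (hu x)).clm_apply (hu x))

theorem SmoothField.crossForm {w u : VField 3 M} (hw : SmoothField w) (hu : SmoothField u)
    (o : MOrientation 3 M) : SmoothForm (crossForm o w u) := by
  intro x
  refine contDiffOn_alternating_iff.2 fun v => ?_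
  refine ContDiffOn.congr ?_ fun z hz => formInChart_crossForm o w u x hz v
  have hws := contDiffOn_euclidean.1 (hw x)
  have hus := contDiffOn_euclidean.1 (hu x)
  simp only [formInChart_volForm, det_basisFun]
  have hw0 := hws 0
  have hw1 := hws 1
  have hw2 := hws 2
  have hu0 := hus 0
  have hu1 := hus 1
  have hu2 := hus 2
  have hc := contDiffOn_volDensity o x
  fun_prop

theorem extD_kineticEnergy_apply {u : VField 3 M} (hu : SmoothField u) (x : M)
    (v : Fin 1 → TangentSpace (𝓡 3) x) :
    extD (kineticEnergy u) x v = inner ℝ (leviCivita u x (v 0)) (u x) := by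
  have hz := mem_extChartAt_target (I := 𝓡 3) x
  have h : extD (kineticEnergy u) x v = extDeriv (formInChart (kineticEnergy u) x)
      (extChartAt (𝓡 3) x x) ![toModel x x (v 0)] := by
    rw [extD, ContinuousAlternatingMap.compContinuousLinearMap_apply]
    congr 1
    ext i
    fin_cases i; rfl
  have hev : (fun z => formInChart (kineticEnergy u) x z ![]) =ᶠ[𝓝 (extChartAt (𝓡 3) x x)]
      fun z => 2⁻¹ * metricInChart x z (fieldInChart u x z) (fieldInChart u x z) := by
    filter_upwards [(isOpen_target x).mem_nhds hz] with z hz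
    exact formInChart_kineticEnergy u x hz _
  have hd := hu.differentiableAt x
  have hg := ((differentiableAt_metricInChart (n := 3) x).clm_apply hd).clm_apply hd
  rw [h, extDeriv_zero_form (hu.kineticEnergy.differentiableAt x hz), hev.fderiv_eq,
    fderiv_const_mul hg, smul_apply, fderiv_metricInChart_apply x hd hd,
    metricInChart_symm x _ (fieldInChart u x _) (fderiv ℝ _ _ _), fieldInChart_self,
    fderiv_metricInChart_eq, ← metricInChart_self x (leviCivita u x (v 0)), toModel_leviCivita,
    map_add, add_apply, metricInChart_self, christoffel_symm x (v 0), smul_eq_mul,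
    real_inner_comm _ (u x)]
  ring

/-- `∇_u ũ = ι_u dũ + d(|u|² / 2)`. -/
theorem flat_advection {u : VField 3 M} (hu : SmoothField u) (o : MOrientation 3 M) :
    flat (fun x => leviCivita u x (u x))
      = crossForm o (sharpField (vorticity o u)) u + extD (kineticEnergy u) := by
  funext x
  ext v
  -- dũ(u, v) = vol(W, u, v) with W dual to the vorticity; computed by the connection, it is ⟨∇_u u,
  -- v⟩ - ⟨∇_v u, u⟩, and the subtracted term is d(|u|²/2)(v).
  have h1 := apply_eq_volForm_sharpField_star o rfl (extD (flat u)) x ![u x, v 0]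
  rw [extD_flat_apply hu] at h1
  have h2 : crossForm o (sharpField (vorticity o u)) u x v
    = inner ℝ (leviCivita u x (u x)) (v 0) - inner ℝ (leviCivita u x (v 0)) (u x) := by
    rw [h1, crossForm_apply]
    rfl
  have h3 := extD_kineticEnergy_apply hu x v
  change inner ℝ (leviCivita u x (u x)) (v 0) = crossForm o (sharpField (vorticity o u)) u x v
    + extD (kineticEnergy u) x v
  rw [h2, h3]
  ring

theorem SmoothField.vorticity {u : VField 3 M} (hu : SmoothField u) (o : MOrientation 3 M) :
    SmoothForm (vorticity o u) :=
  hu.flat.extD.star_two o rfl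

/-- The decomposition into a cross product and an exact form gives smoothness without any study of
how the Christoffel map varies with the point. -/
theorem SmoothField.flat_advection {u : VField 3 M} (hu : SmoothField u) (o : MOrientation 3 M) :
    SmoothForm (NSVorticity.flat fun x => leviCivita u x (u x)) := by
  rw [NSVorticity.flat_advection hu o]
  exact ((hu.vorticity o).sharpField.crossForm hu o).add hu.kineticEnergy.extD

/-- The vorticity field is divergence free, in the form of a derivation identity. -/
theorem volForm_leviCivita_vorticity {u : VField 3 M} (hu : SmoothField u) (o : MOrientation 3 M)
    (x : M) (a b c : TangentSpace (𝓡 3) x) :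
    volForm o x ![leviCivita (sharpField (vorticity o u)) x a, b, c]
      - volForm o x ![leviCivita (sharpField (vorticity o u)) x b, a, c]
      + volForm o x ![leviCivita (sharpField (vorticity o u)) x c, a, b] = 0 := by
  set W := sharpField (vorticity o u) with hW
  have hWs : SmoothField W := (hu.vorticity o).sharpField
  have hz := mem_extChartAt_target (I := 𝓡 3) x
  have hdd : extD (extD (flat u)) x ![a, b, c] = 0 := by
    rw [extD_extD hu.flat]
    rfl
  have h : extD (extD (flat u)) x ![a, b, c] = extDeriv (formInChart (extD (flat u)) x)
      (extChartAt (𝓡 3) x x) ![toModel x x a, toModel x x b, toModel x x c] := by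
    rw [extD, ContinuousAlternatingMap.compContinuousLinearMap_apply]
    congr 1
    ext i
    fin_cases i <;> rfl
  have hev : ∀ b c : TangentSpace (𝓡 3) x,
      (fun z => formInChart (extD (flat u)) x z ![toModel x x b, toModel x x c])
        =ᶠ[𝓝 (extChartAt (𝓡 3) x x)] fun z => formInChart (volForm o) x z
          ![fieldInChart W x z, toModel x x b, toModel x x c] := by
    intro b c
    filter_upwards [(isOpen_target x).mem_nhds hz] with z hz
    exact formInChart_eq_volForm_sharpField_star o rfl _ x hz _
  have hfd : ∀ a b c : TangentSpace (𝓡 3) x,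
      fderiv ℝ (fun z => formInChart (extD (flat u)) x z ![toModel x x b, toModel x x c])
        (extChartAt (𝓡 3) x x) (toModel x x a)
      = volForm o x ![leviCivita W x a, b, c] + volForm o x ![W x, christoffel x a b, c]
        + volForm o x ![W x, b, christoffel x a c] := by
    intro a b c
    rw [(hev b c).fderiv_eq]
    exact fderiv_volForm_fields o x a (hWs.hasCovDerivInChart x a) (hasCovDerivInChart_const x a b)
      (hasCovDerivInChart_const x a c)
  rw [h, extDeriv_two_form (hu.flat.extD.differentiableAt x hz), hfd, hfd, hfd] at hdd
  -- The identity is ddũ = 0 with dũ written as vol(W, ⬝, ⬝). The Christoffel terms cancel in pairs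
  -- by the symmetry of Γ and the antisymmetry of vol.
  have hs := fun y z => alternating_three_swap_right (volForm o x) (W x) y z
  rw [christoffel_symm x b a, christoffel_symm x c a, christoffel_symm x c b,
    hs (christoffel x a c) b] at hdd
  linear_combination hdd

/-- The curl of the advection term. -/
theorem star_extD_flat_advection {u : VField 3 M} (hu : SmoothField u) (o : MOrientation 3 M)
    (x : M) (hdiv : div u x = 0) :
    star o (p := 2) (q := 1) rfl (extD (flat fun y => leviCivita u y (u y))) x
      = covForm (vorticity o u) x (u x) - insertEndo (vorticity o u x) (symGrad u x) := by
  set W := sharpField (vorticity o u) with hW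
  have hWs : SmoothField W := (hu.vorticity o).sharpField
  have hωW : vorticity o u = flat W := (flat_sharpField _).symm
  have hz := mem_extChartAt_target (I := 𝓡 3) x
  have hcs := hWs.crossForm hu o
  have hext : extD (flat fun y => leviCivita u y (u y)) = extD (crossForm o W u) := by
    rw [flat_advection hu o, extD_add hcs hu.kineticEnergy.extD, extD_extD hu.kineticEnergy,
      add_zero]
  have hfd : ∀ a b : TangentSpace (𝓡 3) x,
      fderiv ℝ (fun z => formInChart (crossForm o W u) x z ![toModel x x b])
        (extChartAt (𝓡 3) x x) (toModel x x a)
      = volForm o x ![leviCivita W x a, u x, b] + volForm o x ![W x, leviCivita u x a, b]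
        + volForm o x ![W x, u x, christoffel x a b] := by
    intro a b
    have hev : (fun z => formInChart (crossForm o W u) x z ![toModel x x b])
        =ᶠ[𝓝 (extChartAt (𝓡 3) x x)] fun z => formInChart (volForm o) x z
          ![fieldInChart W x z, fieldInChart u x z, toModel x x b] := by
      filter_upwards [(isOpen_target x).mem_nhds hz] with z hz
      exact formInChart_crossForm o W u x hz _
    rw [hev.fderiv_eq]
    exact fderiv_volForm_fields o x a (hWs.hasCovDerivInChart x a) (hu.hasCovDerivInChart x a)
      (hasCovDerivInChart_const x a b)
  -- d of vol(W, u, ⬝) is the contraction of vol with ∇_u W - ∇_W u. The derivatives of W combine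
  -- through div W = 0 (`hWd`), those of u through div u = 0 (`hud`), and the Christoffel terms
  -- cancel by symmetry.
  have hd : ∀ a b : TangentSpace (𝓡 3) x, extD (crossForm o W u) x ![a, b]
      = (o.orient x).volumeForm ![leviCivita W x (u x) - leviCivita u x (W x), a, b] := by
    intro a b
    have h : extD (crossForm o W u) x ![a, b] = extDeriv (formInChart (crossForm o W u) x)
        (extChartAt (𝓡 3) x x) ![toModel x x a, toModel x x b] := by
      rw [extD, ContinuousAlternatingMap.compContinuousLinearMap_apply]
      congr 1
      ext i
      fin_cases i <;> rfl
    rw [h, extDeriv_one_form (hcs.differentiableAt x hz), hfd, hfd, christoffel_symm x b a,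
      ← volForm_apply, alternating_three_sub_zero]
    have hWd := volForm_leviCivita_vorticity hu o x a (u x) b
    have hud := alternating_three_trace (V := TangentSpace (𝓡 3) x)
      ((o.orient x).finOrthonormalBasis (by norm_num : 0 < 3) Fact.out).toBasis
      (volForm o x).toAlternatingMap (leviCivita u x).toLinearMap (W x) a b
    simp only [ContinuousAlternatingMap.coe_toAlternatingMap, ContinuousLinearMap.coe_coe] at hud
    rw [show LinearMap.trace ℝ _ (leviCivita u x).toLinearMap = 0 from hdiv, zero_mul] at hud
    rw [← hW] at hWd
    have h1 := alternating_three_swap_right (volForm o x) (W x) a (leviCivita u x b)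
    have h2 := alternating_three_swap_right (volForm o x) (leviCivita W x b) a (u x)
    linear_combination hWd + hud - h1 - h2
  -- The antisymmetric part of ∇u is dũ up to a factor, and dũ(W, ⬝) = vol(W, W, ⬝) = 0.
  have hsymm : inner ℝ (leviCivita u x (W x)) = fun a => inner ℝ (leviCivita u x a) (W x) := by
    funext a
    have h1 := extD_flat_apply hu x (W x) a
    have h2 : extD (flat u) x ![W x, a] = volForm o x ![W x, W x, a] :=
      apply_eq_volForm_sharpField_star o rfl (extD (flat u)) x ![W x, a]
    have h3 : volForm o x ![W x, W x, a] = 0 :=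
      (volForm o x).map_eq_zero_of_eq _ (i := 0) (j := 1) rfl (by decide)
    linarith
  ext v
  have hL := hodgeStar_two_apply (o.orient x) rfl (extD (crossForm o W u) x) _ hd v
  have hC := covForm_flat_apply hWs x (u x) v
  -- The two halves of ∇ˢu contribute ⟨W, ∇_v u⟩ / 2 and ⟨∇_W u, v⟩ / 2, which agree by `hsymm`.
  have hI : insertEndo (flat W x) (symGrad u x) v = inner ℝ (leviCivita u x (W x)) (v 0) := by
    change ∑ i, flat W x (Function.update v i (symGrad u x (v i))) = _
    have hS : symGrad u x (v 0) = (2⁻¹ : ℝ) • (leviCivita u x (v 0)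
      + (leviCivita u x).adjoint (v 0)) := rfl
    rw [Fin.sum_univ_one, flat_apply, Function.update_self, hS, inner_smul_right, inner_add_right,
      ContinuousLinearMap.adjoint_inner_right, hsymm, real_inner_comm _ (W x)]
    ring
  rw [hext, hωW, ContinuousAlternatingMap.sub_apply, hC, hI, star, hL, inner_sub_left]

end Advection

/-! ### Time derivatives, up to the end points of J, of fields and of the vorticity. -/

section TimeDerivative

theorem interior_nonempty_of_ordConnected {J : Set ℝ} (hJ : J.OrdConnected) (hJ' : J.Nontrivial) :
    (interior J).Nonempty := by
  obtain ⟨a, ha, b, hb, hab⟩ := hJ'.exists_lt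
  have h : Set.Ioo a b ⊆ interior J :=
    interior_maximal (Set.Ioo_subset_Icc_self.trans (hJ.out ha hb)) isOpen_Ioo
  exact (Set.nonempty_Ioo.2 hab).mono h

theorem uniqueDiffOn_of_ordConnected {J : Set ℝ} (hJ : J.OrdConnected) (hJ' : J.Nontrivial) :
    UniqueDiffOn ℝ J :=
  uniqueDiffOn_convex hJ.convex (interior_nonempty_of_ordConnected hJ hJ')

/-- The time derivative commutes with the space derivative. -/
theorem hasDerivWithinAt_fderiv_comm {E F : Type*} [NormedAddCommGroup E] [NormedSpace ℝ E]
    [NormedAddCommGroup F] [NormedSpace ℝ F] {J : Set ℝ} (hJ : J.OrdConnected)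
    (hJ' : J.Nontrivial) {T : Set E} (hT : IsOpen T) {f : ℝ → E → F}
    (hf : ContDiffOn ℝ ∞ (fun q : ℝ × E => f q.1 q.2) (J ×ˢ T)) {t : ℝ} (ht : t ∈ J) {z : E}
    (hz : z ∈ T) :
    HasDerivWithinAt (fun s => fderiv ℝ (f s) z)
      (fderiv ℝ (fun z => derivWithin (fun s => f s z) J t) z) J t := by
  have hJu := uniqueDiffOn_of_ordConnected hJ hJ'
  have hSu : UniqueDiffOn ℝ (J ×ˢ T) := hJu.prod hT.uniqueDiffOn
  set g : ℝ × E → F := fun q => f q.1 q.2 with hg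
  set g' := fderivWithin ℝ g (J ×ˢ T) with hg'
  have hd : ∀ s ∈ J, ∀ y ∈ T, HasFDerivWithinAt g (g' (s, y)) (J ×ˢ T) (s, y) := fun s hs y hy =>
    (hf.differentiableOn (by simp) (s, y) ⟨hs, hy⟩).hasFDerivWithinAt
  have hd' : HasFDerivWithinAt g' (fderivWithin ℝ g' (J ×ˢ T) (t, z)) (J ×ˢ T) (t, z) :=
    (((hf.fderivWithin (m := ∞) hSu (by simp)).differentiableOn (by simp))
      (t, z) ⟨ht, hz⟩).hasFDerivWithinAt
  set g'' := fderivWithin ℝ g' (J ×ˢ T) (t, z) with hg''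
  have hspace : ∀ s ∈ J, fderiv ℝ (f s) z = g' (s, z) ∘L ContinuousLinearMap.inr ℝ ℝ E := by
    intro s hs
    have h1 := (hd s hs z hz).comp z (hasFDerivAt_prodMk_right s z).hasFDerivWithinAt (s := T)
      fun y hy => ⟨hs, hy⟩
    exact (h1.hasFDerivAt (hT.mem_nhds hz)).fderiv
  have htime : ∀ y ∈ T, derivWithin (fun s => f s y) J t = g' (t, y) (1, 0) := by
    intro y hy
    have h1 := (hd t ht y hy).comp_hasDerivWithinAt (s := J) t
      ((hasDerivWithinAt_id t J).prodMk (hasDerivWithinAt_const t J y))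
      fun s hs => (show (s, y) ∈ J ×ˢ T from ⟨hs, hy⟩)
    exact h1.derivWithin (hJu t ht)
  have hL : HasDerivWithinAt (fun s => fderiv ℝ (f s) z)
      (g'' (1, 0) ∘L ContinuousLinearMap.inr ℝ ℝ E) J t := by
    have h1 := hd'.comp_hasDerivWithinAt (s := J) t
      ((hasDerivWithinAt_id t J).prodMk (hasDerivWithinAt_const t J z))
      fun s hs => (show (s, z) ∈ J ×ˢ T from ⟨hs, hz⟩)
    have h2 := ((ContinuousLinearMap.compL ℝ E (ℝ × E) F).flip
      (ContinuousLinearMap.inr ℝ ℝ E)).hasFDerivAt.comp_hasDerivWithinAt t h1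
    exact h2.congr (fun s hs => hspace s hs) (hspace t ht)
  have hR : HasFDerivAt (fun y => derivWithin (fun s => f s y) J t)
      ((g''.flip (1, 0)) ∘L ContinuousLinearMap.inr ℝ ℝ E) z := by
    have h1 := (hd'.comp z (hasFDerivAt_prodMk_right t z).hasFDerivWithinAt (s := T)
      fun y hy => ⟨ht, hy⟩).hasFDerivAt (hT.mem_nhds hz)
    have h2 := (ContinuousLinearMap.apply ℝ F ((1, 0) : ℝ × E)).hasFDerivAt.comp z h1
    refine (h2.congr_of_eventuallyEq ?_).congr_fderiv ?_
    · filter_upwards [hT.mem_nhds hz] with y hy using htime y hy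
    · rfl
  rw [hR.fderiv]
  refine hL.congr_deriv ?_
  -- At an end point of J the second derivative is taken within the set; its symmetry holds because
  -- the point is a limit of interior points, J being a nontrivial interval.
  have hcl : (t, z) ∈ closure (interior (J ×ˢ T)) := by
    rw [interior_prod_eq, closure_prod_eq, hT.interior_eq,
      (hJ.convex (𝕜 := ℝ)).closure_interior_eq_closure_of_nonempty_interior
        (interior_nonempty_of_ordConnected hJ hJ')]
    exact ⟨subset_closure ht, subset_closure hz⟩
  have hsymm := (hf (t, z) ⟨ht, hz⟩).isSymmSndFDerivWithinAt minSmoothness_two_le hSu hcl ⟨ht, hz⟩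
  ext h
  exact hsymm.eq (1, 0) (0, h)

end TimeDerivative

section NavierStokesTime

/-- Composition of a vector-valued function with a continuous linear map into a topological
vector space. -/
theorem _root_.ContinuousLinearMap.comp_hasDerivWithinAt {F G : Type*} [AddCommGroup F]
    [Module ℝ F] [TopologicalSpace F] [ContinuousSMul ℝ F] [AddCommGroup G] [Module ℝ G]
    [TopologicalSpace G] [ContinuousSMul ℝ G]
    (L : F →L[ℝ] G) {f : ℝ → F} {f' : F} {s : Set ℝ} {x : ℝ} (h : HasDerivWithinAt f f' s x) :
    HasDerivWithinAt (fun y => L (f y)) (L f') s x := by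
  refine .of_isLittleOTVS ((L.isBigOTVS_comp.trans_isLittleOTVS h.isLittleOTVS).congr_left ?_)
  intro q
  simp

variable {M : Type*} [TopologicalSpace M] [ChartedSpace (EuclideanSpace ℝ (Fin 3)) M]
  [IsManifold (𝓡 3) ∞ M]

/-- A smooth time-dependent field is jointly smooth in every chart. -/
theorem contDiffOn_fieldInChart_prod {J : Set ℝ} {u : ℝ → VField 3 M}
    (hu : ContMDiffOn (𝓘(ℝ, ℝ).prod (𝓡 3)) (𝓡 3).tangent ∞
      (fun z : ℝ × M =>
        (⟨z.2, u z.1 z.2⟩ : TotalSpace (Model 3) (TangentSpace (𝓡 3) : M → Type _)))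
      (J ×ˢ Set.univ)) (x : M) :
    ContDiffOn ℝ ∞ (fun q : ℝ × Model 3 => fieldInChart (u q.1) x q.2)
      (J ×ˢ (extChartAt (𝓡 3) x).target) := by
  have h1 := hu.mono (Set.prod_mono_right (Set.subset_univ (extChartAt (𝓡 3) x).source))
  have h2 := ((contMDiffOn_fieldAlong_iff x fun q hq => hq.2).1 h1).2
  have h3 : ContMDiffOn (𝓘(ℝ, ℝ).prod 𝓘(ℝ, Model 3)) (𝓘(ℝ, ℝ).prod (𝓡 3)) ∞
      (fun q : ℝ × Model 3 => (q.1, (extChartAt (𝓡 3) x).symm q.2))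
      (J ×ˢ (extChartAt (𝓡 3) x).target) :=
    contMDiffOn_fst.prodMk
      ((contMDiffOn_extChartAt_symm x).comp contMDiffOn_snd fun q hq => hq.2)
  have h4 := h2.comp h3 fun q hq => ⟨hq.1, (extChartAt (𝓡 3) x).map_target hq.2⟩
  rw [← contMDiffOn_iff_contDiffOn, modelWithCornersSelf_prod, ← chartedSpaceSelf_prod]
  exact h4

theorem smoothField_of_contMDiffOn_prod {J : Set ℝ} {u : ℝ → VField 3 M}
    (hu : ContMDiffOn (𝓘(ℝ, ℝ).prod (𝓡 3)) (𝓡 3).tangent ∞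
      (fun z : ℝ × M =>
        (⟨z.2, u z.1 z.2⟩ : TotalSpace (Model 3) (TangentSpace (𝓡 3) : M → Type _)))
      (J ×ˢ Set.univ)) {t : ℝ} (ht : t ∈ J) : SmoothField (u t) := fun x =>
  (contDiffOn_fieldInChart_prod hu x).comp (contDiff_prodMk_right t).contDiffOn
    fun _ hz => ⟨ht, hz⟩

variable [RiemannianBundle (fun x : M => TangentSpace (𝓡 3) x)]

theorem hasDerivWithinAt_fieldInChart {J : Set ℝ} {u : ℝ → VField 3 M}
    (hu : ContMDiffOn (𝓘(ℝ, ℝ).prod (𝓡 3)) (𝓡 3).tangent ∞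
      (fun z : ℝ × M =>
        (⟨z.2, u z.1 z.2⟩ : TotalSpace (Model 3) (TangentSpace (𝓡 3) : M → Type _)))
      (J ×ˢ Set.univ)) {t : ℝ} (ht : t ∈ J) (x : M) {z : Model 3}
    (hz : z ∈ (extChartAt (𝓡 3) x).target) :
    HasDerivWithinAt (fun s => fieldInChart (u s) x z)
      (fieldInChart (fun y => derivWithin (fun s => u s y) J t) x z) J t := by
  set y := (extChartAt (𝓡 3) x).symm z with hy
  have h1 : DifferentiableWithinAt ℝ (fun s => fieldInChart (u s) x z) J t := by
    have := (contDiffOn_fieldInChart_prod hu x).comp (s := J) (f := fun s : ℝ => (s, z))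
      (contDiff_prodMk_left z).contDiffOn fun s hs => ⟨hs, hz⟩
    exact this.differentiableOn (by simp) t ht
  have h2 : DifferentiableWithinAt ℝ (fun s => u s y) J t := by
    -- Joint smoothness gives differentiability of the chart expression only; applying the fixed map
    -- `ofModel x z` transfers it to the vector u s y itself.
    have h3 := (ofModel x z).hasFDerivAt.comp_hasFDerivWithinAt t h1.hasFDerivWithinAt
    refine (h3.congr (fun s hs => ?_) ?_).differentiableWithinAt <;>
      exact (ofModel_toModel x hz _).symm
  exact (toModel x y).hasFDerivAt.comp_hasDerivWithinAt t h2.hasDerivWithinAt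

variable [IsContMDiffRiemannianBundle (𝓡 3) ∞ (EuclideanSpace ℝ (Fin 3))
      (fun x : M => TangentSpace (𝓡 3) x)]

theorem contDiffOn_formInChart_flat_prod {J : Set ℝ} {u : ℝ → VField 3 M}
    (hu : ContMDiffOn (𝓘(ℝ, ℝ).prod (𝓡 3)) (𝓡 3).tangent ∞
      (fun z : ℝ × M =>
        (⟨z.2, u z.1 z.2⟩ : TotalSpace (Model 3) (TangentSpace (𝓡 3) : M → Type _)))
      (J ×ˢ Set.univ)) (x : M) :
    ContDiffOn ℝ ∞ (fun q : ℝ × Model 3 => formInChart (flat (u q.1)) x q.2)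
      (J ×ˢ (extChartAt (𝓡 3) x).target) := by
  refine contDiffOn_alternating_iff.2 fun v => ?_
  refine ContDiffOn.congr ?_ fun q hq => formInChart_flat (u q.1) x hq.2 v
  have hg : ContDiffOn ℝ ∞ (fun q : ℝ × Model 3 => metricInChart x q.2)
      (J ×ˢ (extChartAt (𝓡 3) x).target) :=
    (contDiffOn_metricInChart x).comp contDiff_snd.contDiffOn fun q hq => hq.2
  exact (hg.clm_apply (contDiffOn_fieldInChart_prod hu x)).clm_apply contDiffOn_const

/-- The time derivative commutes with `∗d` on the `1`-forms dual to a smooth time-dependent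
field. -/
theorem hasDerivWithinAt_vorticity (o : MOrientation 3 M) {J : Set ℝ} {u : ℝ → VField 3 M}
    (hJ : J.OrdConnected) (hJ' : J.Nontrivial)
    (hu : ContMDiffOn (𝓘(ℝ, ℝ).prod (𝓡 3)) (𝓡 3).tangent ∞
      (fun z : ℝ × M =>
        (⟨z.2, u z.1 z.2⟩ : TotalSpace (Model 3) (TangentSpace (𝓡 3) : M → Type _)))
      (J ×ˢ Set.univ)) {t : ℝ} (ht : t ∈ J) (x : M) :
    HasDerivWithinAt (fun s => vorticity o (u s) x)
      (vorticity o (fun y => derivWithin (fun s => u s y) J t) x) J t := by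
  set z₀ := extChartAt (𝓡 3) x x with hz₀
  have hz : z₀ ∈ (extChartAt (𝓡 3) x).target := mem_extChartAt_target x
  have hf := contDiffOn_formInChart_flat_prod hu x
  have hJu := uniqueDiffOn_of_ordConnected hJ hJ'
  have h1 := hasDerivWithinAt_fderiv_comm (f := fun s => formInChart (flat (u s)) x) hJ hJ'
    (isOpen_target x) hf ht hz
  -- The metric does not depend on time, so ∂ₜ commutes with lowering the index.
  have hev : (fun z => derivWithin (fun s => formInChart (flat (u s)) x z) J t) =ᶠ[𝓝 z₀]
      formInChart (flat fun y => derivWithin (fun s => u s y) J t) x := by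
    filter_upwards [(isOpen_target x).mem_nhds hz] with z hz
    have hd : DifferentiableWithinAt ℝ (fun s => formInChart (flat (u s)) x z) J t := by
      have := hf.comp (s := J) (f := fun s : ℝ => (s, z)) (contDiff_prodMk_left z).contDiffOn
        fun s hs => ⟨hs, hz⟩
      exact this.differentiableOn (by simp) t ht
    ext v
    have h2 := (ContinuousAlternatingMap.apply ℝ (Model 3) ℝ v).hasFDerivAt.comp_hasDerivWithinAt t
      hd.hasDerivWithinAt
    have h3 := ((metricInChart x z).flip (v 0)).hasFDerivAt.comp_hasDerivWithinAt t
      (hasDerivWithinAt_fieldInChart hu ht x hz)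
    have h4 := h3.congr (f₁ := fun s => formInChart (flat (u s)) x z v)
      (fun s _ => formInChart_flat (u s) x hz v) (formInChart_flat (u t) x hz v)
    rw [formInChart_flat _ x hz]
    exact (hJu t ht).eq_deriv _ h2 h4
  rw [hev.fderiv_eq] at h1
  -- At the fixed point x the vorticity is a fixed linear function of the space derivative of ũ in
  -- the chart: antisymmetrize (`L₁`), then pull back to the tangent space and apply the star
  -- (`L₂`).
  let L₁ : (Model 3 →L[ℝ] Model 3 [⋀^Fin 1]→L[ℝ] ℝ) →L[ℝ] Model 3 [⋀^Fin 2]→L[ℝ] ℝ :=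
    ContinuousAlternatingMap.alternatizeUncurryFinCLM ℝ (Model 3) ℝ
  let L₂ : (Model 3 [⋀^Fin 2]→L[ℝ] ℝ) →ₗ[ℝ] TangentSpace (𝓡 3) x [⋀^Fin 1]→L[ℝ] ℝ :=
    { toFun := fun β => hodgeStar (o.orient x) (p := 2) (q := 1) rfl
        (β.compContinuousLinearMap (toModel x x))
      map_add' := fun α β => by
        simp [hodgeStar, add_smul, Finset.sum_add_distrib]
      map_smul' := fun c α => by
        simp [hodgeStar, mul_smul, Finset.smul_sum, smul_comm c] }
  have h2 := L₁.hasFDerivAt.comp_hasDerivWithinAt t h1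
  exact (LinearMap.toContinuousLinearMap L₂).comp_hasDerivWithinAt h2

end NavierStokesTime

/-- The value of a derivative within a set, for functions into a topological vector space. -/
theorem derivWithin_eq_of_hasDerivWithinAt {G : Type*} [AddCommGroup G] [Module ℝ G]
    [TopologicalSpace G] [ContinuousAdd G] [ContinuousSMul ℝ G] [T2Space G] {f : ℝ → G} {f' : G}
    {s : Set ℝ} {x : ℝ} (h : HasDerivWithinAt f f' s x) (hs : UniqueDiffWithinAt ℝ s x) :
    derivWithin f s x = f' := by
  rw [derivWithin, h.hasFDerivWithinAt.fderivWithin hs, ContinuousLinearMap.toSpanSingleton_apply,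
    one_smul]

/-! ### The gradient of the pressure as an exact form. -/

section Pressure

variable {n : ℕ} {M : Type*} [TopologicalSpace M] [ChartedSpace (EuclideanSpace ℝ (Fin n)) M]

/-- A function as a `0`-form. -/
def functionForm (f : M → ℝ) : DForm n M 0 := fun x =>
  ContinuousAlternatingMap.constOfIsEmpty ℝ (TangentSpace (𝓡 n) x) (Fin 0) (f x)

variable [IsManifold (𝓡 n) ∞ M]

theorem smoothForm_functionForm {f : M → ℝ} (hf : ContMDiff (𝓡 n) 𝓘(ℝ, ℝ) ∞ f) :
    SmoothForm (functionForm (n := n) f) := by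
  intro x
  refine contDiffOn_alternating_iff.2 fun v => ?_
  rw [← contMDiffOn_iff_contDiffOn]
  exact hf.comp_contMDiffOn (contMDiffOn_extChartAt_symm x)

variable [RiemannianBundle (fun x : M => TangentSpace (𝓡 n) x)]

theorem flat_grad {f : M → ℝ} (hf : ContMDiff (𝓡 n) 𝓘(ℝ, ℝ) ∞ f) :
    flat (grad f) = extD (functionForm (n := n) f) := by
  funext x
  ext v
  have hz := mem_extChartAt_target (I := 𝓡 n) x
  have hs := smoothForm_functionForm (n := n) hf
  have h : extD (functionForm f) x v = extDeriv (formInChart (functionForm f) x)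
      (extChartAt (𝓡 n) x x) ![toModel x x (v 0)] := by
    rw [extD, ContinuousAlternatingMap.compContinuousLinearMap_apply]
    congr 1
    ext i
    fin_cases i; rfl
  have hd : DifferentiableAt ℝ (fun z => f ((extChartAt (𝓡 n) x).symm z)) (extChartAt (𝓡 n) x x) :=
    (hs.differentiableAt x hz).continuousAlternatingMap_apply_const ![]
  have hm : HasMFDerivAt (𝓡 n) 𝓘(ℝ, ℝ) f x
      ((fderiv ℝ (fun z => f ((extChartAt (𝓡 n) x).symm z)) (extChartAt (𝓡 n) x x)) ∘L
        toModel x x) := by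
    have h1 := hd.hasFDerivAt.hasMFDerivAt
    have h2 : HasMFDerivAt (𝓡 n) 𝓘(ℝ, Model n) (extChartAt (𝓡 n) x) x (toModel x x) :=
      (mdifferentiableAt_extChartAt (mem_chart_source _ x)).hasMFDerivAt
    refine (h1.comp x h2).congr_of_eventuallyEq ?_
    filter_upwards [extChartAt_source_mem_nhds (I := 𝓡 n) x] with y hy
    exact congrArg f ((extChartAt (𝓡 n) x).left_inv hy).symm
  rw [h, extDeriv_zero_form (hs.differentiableAt x hz), flat_apply, grad]
  refine (inner_sharp _ _).trans ?_
  exact DFunLike.congr_fun hm.mfderiv (v 0)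

end Pressure

end

end NSVorticity

/-! ### The vorticity equation. -/

open NSVorticity

theorem mainTheorem10 {M : Type*} [TopologicalSpace M]
    [ChartedSpace (EuclideanSpace ℝ (Fin 3)) M] [IsManifold (𝓡 3) ∞ M]
    [RiemannianBundle (fun x : M => TangentSpace (𝓡 3) x)]
    [IsContMDiffRiemannianBundle (𝓡 3) ∞ (EuclideanSpace ℝ (Fin 3))
      (fun x : M => TangentSpace (𝓡 3) x)]
    (o : NSVorticity.MOrientation 3 M) (ν : ℝ)
    (J : Set ℝ) (hJ : J.OrdConnected) (hJ' : J.Nontrivial)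
    (u : ℝ → NSVorticity.VField 3 M) (p : ℝ → M → ℝ)
    (hu : NSVorticity.IsSmoothNSSolution o ν J u p) :
    ∀ t ∈ J, ∀ x : M,
      DifferentiableWithinAt ℝ (fun s => NSVorticity.vorticity o (u s) x) J t ∧
      derivWithin (fun s => NSVorticity.vorticity o (u s) x) J t
          + NSVorticity.covForm (NSVorticity.vorticity o (u t)) x (u t x)
          + ν • NSVorticity.laplacianForm o (NSVorticity.vorticity o (u t)) x
        = NSVorticity.insertEndo (NSVorticity.vorticity o (u t) x)
            (NSVorticity.symGrad (u t) x) := by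
  intro t ht x
  have hd := hasDerivWithinAt_vorticity o hJ hJ' hu.smooth_velocity ht x
  refine ⟨hd.hasFDerivWithinAt.differentiableWithinAt, ?_⟩
  rw [derivWithin_eq_of_hasDerivWithinAt hd (uniqueDiffOn_of_ordConnected hJ hJ' t ht)]
  have hus : SmoothField (u t) := smoothField_of_contMDiffOn_prod hu.smooth_velocity ht
  have hps := smoothForm_functionForm (n := 3) (hu.smooth_pressure t ht)
  have hls := hus.flat.laplacianForm o
  -- The momentum equation is solved for ∂ₜu as an identity of fields on all of M, since ∗d is
  -- applied to it. The right side consists of terms known to be smooth, as additivity of d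
  -- requires.
  have hmom : (fun y => derivWithin (fun s => u s y) J t)
      = (-1 : ℝ) • (grad (p t) + ((fun y => leviCivita (u t) y (u t y))
        + ν • laplacianField o (u t))) := by
    funext y
    have h := hu.momentum t ht y
    change _ = (-1 : ℝ) • (grad (p t) y + (leviCivita (u t) y (u t y)
      + ν • laplacianField o (u t) y))
    rw [neg_one_smul, neg_add, ← h]
    abel
  have hadv := hus.flat_advection o
  -- Here d² = 0 removes the pressure, and ∗d is moved past the Laplacian.
  have hω : vorticity o (fun y => derivWithin (fun s => u s y) J t)
      = (-1 : ℝ) • (star o (p := 2) (q := 1) rfl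
          (extD (flat fun y => leviCivita (u t) y (u t y)))
        + ν • laplacianForm o (vorticity o (u t))) := by
    rw [hmom, vorticity, vorticity, flat_smul, flat_add, flat_add, flat_smul,
      flat_grad (hu.smooth_pressure t ht), laplacianField, flat_sharpField, extD_smul,
      extD_add hps.extD (hadv.add (hls.smul ν)), extD_extD hps, zero_add,
      extD_add hadv (hls.smul ν), extD_smul, NSVorticity.star_smul,
      NSVorticity.star_add, NSVorticity.star_smul,
      laplacianForm_star_extD hus.flat]
  rw [hω]
  change (-1 : ℝ) • (star o (p := 2) (q := 1) rfl
      (extD (flat fun y => leviCivita (u t) y (u t y))) x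
    + ν • laplacianForm o (vorticity o (u t)) x) + _ + _ = _
  rw [star_extD_flat_advection hus o x (hu.incompressible t ht x)]
  have key : ∀ {V : Type _} [AddCommGroup V] [Module ℝ V] (a b c : V),
      (-1 : ℝ) • (a - b + c) + a + c = b := fun a b c => by
    rw [neg_one_smul]
    abel
  exact key _ _ _
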